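/- **Setting.** A *metric structure* $M$ is a nonempty complete metric space of bounded diameter with a family of uniformly continuous bounded basic predicates $M^{n_i}\to\mathbb{R}$ ($n_i<\omega$). *Definable predicates* $M^\alpha\to\mathbb{R}$ ($\alpha$ countable, possibly finite) are the functions obtained from the basic predicates and the distance by continuous combinations, rearranging of variables, suprema and infima over variables, and uniform limits. A *formula* $f(x,y)$ is a definable predicate $f\colon M^\alpha\times M^\beta\to\mathbb{R}$ with $\alpha,\beta$ countable. For $C\subset M$, a *$C$-definable predicate* is a function $f_a\colon b\mapsto f(a,b)$ with $f(x,y)$ a formula and $a$ a countable tuple from $C$; a *type over $C$* in a countable variable $y$ is a maximal ideal of the algebra of $C$-definable predicates in $y$, the set of these is $S_y(C)$, and $\mathrm{tp}(b/C)$, the type realized by $b$, is the ideal of the predicates vanishing at $b$. An $M$-definable predicate $h$ extends to $\tilde h\colon S_y(M)\to\mathbb{R}$, where $\tilde h(p)$ is the unique real $r$ with $h-r\in p$. $M$ is *$\emptyset$-saturated* if every type over $\emptyset$ in countably many variables is realized in $M$. An *elementary extension* of $M$ is a structure $N\supset M$ in the same signature whose metric and basic predicates extend those of $M$ and such that every type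 over $M$ in $N$, in countably many variables, is approximately finitely realized in $M$ (for finitely many of its members $h_k$ and $\epsilon>0$ some tuple $b$ from $M$ has $|h_k(b)|<\epsilon$ for all $k$); definable predicates of $M$ extend uniquely to definable predicates of $N$, denoted by the same symbols. Powers $M^\alpha$ carry the distance $d(x,y)=\sup_i 2^{-i}d(x_i,y_i)$, and a closed set $A\subset M^\alpha$ is *definable* if $P_A(x)=d(x,A)$ is a definable predicate (with $P_\emptyset=1$). A sequence $(a_i)_{i<\omega}$ in $M^\alpha$ is *indiscernible* if $\mathrm{tp}(a_{i_1}\cdots a_{i_k}/\emptyset)=\mathrm{tp}(a_0\cdots a_{k-1}/\emptyset)$ for all $k$ and $i_1<\dots<i_k<\omega$. A subset of a topological space $X$ is *sequentially precompact* if each sequence of its elements has a subsequence converging in $X$. **Statement.** Let $M$ be a $\emptyset$-saturated metric structure, $f(x,y)$ a formula, and $A\subset M^\alpha$, $B\subset M^\beta$ definable sets. The following are equivalent (and define: $f(x,y)$ is *NIP on $A\times B$*). 1. There do not exist real numbers $r\ne s$, a sequence $(a_i)_{i<\omega}\subset A$ and a family $(b_I)_{I\subset\omega}$ in some elementary extension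 of $M$, with $P_B(b_I)=0$ for all $I\subset\omega$, such that for all $i<\omega$ and $I\subset\omega$: $f(a_i,b_I)=r$ if $i\in I$, and $f(a_i,b_I)=s$ if $i\notin I$. 2. For every indiscernible sequence $(a_i)_{i<\omega}\subset A$ and every $b\in B$, the sequence $(f(a_i,b))_{i<\omega}$ converges in $\mathbb{R}$. 3. For every indiscernible sequence $(a_i)_{i<\omega}\subset A$ and every $b$ in any elementary extension of $M$ with $P_B(b)=0$, the sequence $(f(a_i,b))_{i<\omega}$ converges in $\mathbb{R}$. 4. Every sequence $(a_i)_{i<\omega}\subset A$ admits a subsequence $(a_{i_j})_{j<\omega}$ such that $(f(a_{i_j},b))_{j<\omega}$ converges in $\mathbb{R}$ for every $b$ in any elementary extension of $M$ with $P_B(b)=0$. 5. $\{\tilde f_a|_{B^*}:a\in A\}$ is sequentially precompact in $\mathbb{R}^{B^*}$, where $B^*=\{p\in S_y(M):P_B\in p\}$. Moreover, for every dense subset $A'\subset A$, these conditions are equivalent to the sequential precompactness of $\{\tilde f_a|_{B^*}:a\in A'\}$ in $\mathbb{R}^{B^*}$. -/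

import Mathlib

open Filter Topology

namespace MetricModel

universe u v

/-- The names of the basic predicates of a metric structure, with their (finite) arities. -/
structure Signature where
  Idx : Type v
  arity : Idx → ℕ

/-- A metric structure: a nonempty complete metric space of bounded diameter together with
uniformly continuous bounded basic predicates on its finite powers. -/
structure MetricStructure (L : Signature.{v}) (M : Type u) [MetricSpace M] where
  nonempty : Nonempty M
  complete : CompleteSpace M
  bounded : ∃ D : ℝ, ∀ x y : M, dist x y ≤ D
  pred : ∀ i : L.Idx, (Fin (L.arity i) → M) → ℝ
  pred_unifCont : ∀ i, UniformContinuous (pred i)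
  pred_bounded : ∀ i, ∃ K : ℝ, ∀ x, |pred i x| ≤ K

namespace MetricStructure

variable {L : Signature.{v}} {M : Type u} [MetricSpace M]

/-- Definable predicates in a countable set of variables: the functions obtained from the basic
predicates and the distance by continuous combinations, rearrangement of the variables, suprema
and infima over one variable, and uniform limits. -/
inductive IsDefinable (S : MetricStructure L M) : ∀ {α : Type}, ((α → M) → ℝ) → Prop
  | basic (i : L.Idx) : IsDefinable S (S.pred i)
  | metric : IsDefinable S (fun x : Fin 2 → M => dist (x 0) (x 1))
  | comb {α : Type} [Countable α] {k : ℕ} (u : (Fin k → ℝ) → ℝ) (hu : Continuous u)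
      (f : Fin k → (α → M) → ℝ) (hf : ∀ j, IsDefinable S (f j)) :
      IsDefinable S (fun x => u fun j => f j x)
  | rename {α γ : Type} [Countable γ] (σ : α → γ) {f : (α → M) → ℝ} (hf : IsDefinable S f) :
      IsDefinable S (fun x : γ → M => f (x ∘ σ))
  | sup {α : Type} {f : (Option α → M) → ℝ} (hf : IsDefinable S f) :
      IsDefinable S (fun x : α → M => ⨆ m : M, f (fun o => o.elim m x))
  | inf {α : Type} {f : (Option α → M) → ℝ} (hf : IsDefinable S f) :
      IsDefinable S (fun x : α → M => ⨅ m : M, f (fun o => o.elim m x))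
  | lim {α : Type} (f : ℕ → (α → M) → ℝ) (g : (α → M) → ℝ) (hf : ∀ n, IsDefinable S (f n))
      (h : TendstoUniformly f g atTop) : IsDefinable S g

/-- A bundled definable predicate in the variables `α`. A formula `f(x, y)` with `x` of length `α`
and `y` of length `β` is a definable predicate in the variables `α ⊕ β`. -/
structure DefPred (S : MetricStructure L M) (α : Type) where
  toFun : (α → M) → ℝ
  definable : S.IsDefinable toFun

instance (S : MetricStructure L M) (α : Type) :
    CoeFun (S.DefPred α) (fun _ => (α → M) → ℝ) := ⟨DefPred.toFun⟩

section basics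

variable {S : MetricStructure L M} {α β : Type}

theorem IsDefinable.countable {f : (α → M) → ℝ} (hf : S.IsDefinable f) : Countable α := by
  induction hf with
  | basic i => infer_instance
  | metric => infer_instance
  | comb u hu f hf ih => assumption
  | rename σ hf ih => assumption
  | sup hf ih => exact (Option.some_injective _).countable
  | inf hf ih => exact (Option.some_injective _).countable
  | lim f g hf h ih => exact ih 0

theorem IsDefinable.bounded {f : (α → M) → ℝ} (hf : S.IsDefinable f) :
    ∃ K : ℝ, ∀ x, |f x| ≤ K := by
  have := S.nonempty
  induction hf with
  | basic i => exact S.pred_bounded i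
  | metric =>
    obtain ⟨D, hD⟩ := S.bounded
    exact ⟨D, fun x => by rw [abs_of_nonneg dist_nonneg]; exact hD _ _⟩
  | comb u hu f hf ih =>
    choose K hK using ih
    have hc : IsCompact (Set.pi Set.univ fun j => Set.Icc (-K j) (K j)) :=
      isCompact_univ_pi fun j => isCompact_Icc
    obtain ⟨C, hC⟩ := hc.exists_bound_of_continuousOn hu.continuousOn
    refine ⟨C, fun x => hC _ fun j _ => ?_⟩
    exact abs_le.1 (hK j x)
  | rename σ hf ih =>
    obtain ⟨K, hK⟩ := ih
    exact ⟨K, fun x => hK _⟩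
  | sup hf ih =>
    obtain ⟨K, hK⟩ := ih
    refine ⟨K, fun x => abs_le.2 ⟨?_, ciSup_le fun m => (abs_le.1 (hK _)).2⟩⟩
    exact le_ciSup_of_le ⟨K, by rintro _ ⟨m, rfl⟩; exact (abs_le.1 (hK _)).2⟩
      (Classical.arbitrary M) (abs_le.1 (hK _)).1
  | inf hf ih =>
    obtain ⟨K, hK⟩ := ih
    refine ⟨K, fun x => abs_le.2 ⟨le_ciInf fun m => (abs_le.1 (hK _)).1, ?_⟩⟩
    exact ciInf_le_of_le ⟨-K, by rintro _ ⟨m, rfl⟩; exact (abs_le.1 (hK _)).1⟩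
      (Classical.arbitrary M) (abs_le.1 (hK _)).2
  | lim f g hf h ih =>
    obtain ⟨n, hn⟩ := ((Metric.tendstoUniformly_iff.1 h) 1 one_pos).exists
    obtain ⟨K, hK⟩ := ih n
    refine ⟨K + 1, fun x => ?_⟩
    have h1 := hn x
    rw [Real.dist_eq] at h1
    calc |g x| = |(g x - f n x) + f n x| := by ring_nf
      _ ≤ |g x - f n x| + |f n x| := abs_add_le _ _
      _ ≤ K + 1 := by linarith [hK x]

theorem IsDefinable.comp₁ {f : (α → M) → ℝ} (hf : S.IsDefinable f) {u : ℝ → ℝ}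
    (hu : Continuous u) : S.IsDefinable (fun x => u (f x)) := by
  have := hf.countable
  exact IsDefinable.comb (k := 1) (fun t => u (t 0)) (by fun_prop) (fun _ => f) (fun _ => hf)

theorem IsDefinable.comp₂ {f g : (α → M) → ℝ} (hf : S.IsDefinable f) (hg : S.IsDefinable g)
    {u : ℝ → ℝ → ℝ} (hu : Continuous fun t : ℝ × ℝ => u t.1 t.2) :
    S.IsDefinable (fun x => u (f x) (g x)) := by
  have := hf.countable
  have h := IsDefinable.comb (S := S) (k := 2) (fun t => u (t 0) (t 1))
    (hu.comp (by fun_prop : Continuous fun t : Fin 2 → ℝ => (t 0, t 1))) ![f, g]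
    (by intro j; fin_cases j <;> assumption)
  simpa using h

theorem IsDefinable.const [Countable α] (r : ℝ) :
    S.IsDefinable (fun _ : α → M => r) :=
  IsDefinable.comb (k := 0) (fun _ => r) continuous_const Fin.elim0 (fun j => j.elim0)

end basics

/-- `h` is a `C`-definable predicate in the variables `β`: it is of the form `b ↦ f(a, b)` for a
formula `f(x, y)` and a countable tuple `a` of parameters from `C`. -/
def IsDefinableOver (S : MetricStructure L M) (C : Set M) {β : Type} (h : (β → M) → ℝ) : Prop :=
  ∃ (γ : Type) (f : S.DefPred (γ ⊕ β)) (a : γ → M),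
    (∀ i, a i ∈ C) ∧ ∀ b, h b = f (Sum.elim a b)

theorem IsDefinableOver.comp₂ {S : MetricStructure L M} {C : Set M} {β : Type}
    {g h : (β → M) → ℝ} (hg : S.IsDefinableOver C g) (hh : S.IsDefinableOver C h)
    {u : ℝ → ℝ → ℝ} (hu : Continuous fun t : ℝ × ℝ => u t.1 t.2) :
    S.IsDefinableOver C (fun x => u (g x) (h x)) := by
  obtain ⟨γ, f, a, ha, hf⟩ := hg
  obtain ⟨γ', f', a', ha', hf'⟩ := hh
  have := f.definable.countable
  have := f'.definable.countable
  have i1 : Countable γ := (Sum.inl_injective (β := β)).countable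
  have i2 : Countable γ' := (Sum.inl_injective (β := β)).countable
  have i3 : Countable β := (Sum.inr_injective (α := γ)).countable
  refine ⟨γ ⊕ γ', ⟨_, ((f.definable.rename (γ := (γ ⊕ γ') ⊕ β)
    (Sum.map Sum.inl id)).comp₂ (f'.definable.rename (γ := (γ ⊕ γ') ⊕ β)
    (Sum.map Sum.inr id)) hu)⟩, Sum.elim a a', ?_, ?_⟩
  · rintro (i | i)
    · exact ha i
    · exact ha' i
  · intro b
    have e1 : Sum.elim (Sum.elim a a') b ∘ Sum.map Sum.inl id = Sum.elim a b := by
      ext (i | i) <;> rfl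
    have e2 : Sum.elim (Sum.elim a a') b ∘ Sum.map Sum.inr id = Sum.elim a' b := by
      ext (i | i) <;> rfl
    simp only [hf, hf', e1, e2]

theorem IsDefinable.over {S : MetricStructure L M} {β : Type} {f : (β → M) → ℝ}
    (hf : S.IsDefinable f) (C : Set M) : S.IsDefinableOver C f := by
  have := hf.countable
  exact ⟨Empty, ⟨_, hf.rename (γ := Empty ⊕ β) Sum.inr⟩, fun i => i.elim, fun i => i.elim,
    fun b => rfl⟩

theorem IsDefinableOver.bounded {S : MetricStructure L M} {C : Set M} {β : Type}
    {h : (β → M) → ℝ} (hh : S.IsDefinableOver C h) : ∃ K : ℝ, ∀ x, |h x| ≤ K := by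
  obtain ⟨γ, f, a, ha, hf⟩ := hh
  obtain ⟨K, hK⟩ := f.definable.bounded
  exact ⟨K, fun x => by rw [hf]; exact hK _⟩

/-- The algebra of `C`-definable predicates in the variables `β`. -/
def defAlgebra (S : MetricStructure L M) (C : Set M) (β : Type) [Countable β] :
    Subalgebra ℝ ((β → M) → ℝ) where
  carrier := {h | S.IsDefinableOver C h}
  mul_mem' hg hh := hg.comp₂ hh (u := fun s t => s * t) (by fun_prop)
  add_mem' hg hh := hg.comp₂ hh (u := fun s t => s + t) (by fun_prop)
  algebraMap_mem' r := (IsDefinable.const r).over C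

/-- A complete type over `C` in the variables `β`: a maximal ideal of the algebra of
`C`-definable predicates. -/
abbrev TypeSpace (S : MetricStructure L M) (C : Set M) (β : Type) [Countable β] :=
  MaximalSpectrum (S.defAlgebra C β)

/-- Evaluation of `C`-definable predicates at a tuple. -/
def evalHom (S : MetricStructure L M) (C : Set M) {β : Type} [Countable β] (b : β → M) :
    S.defAlgebra C β →ₐ[ℝ] ℝ :=
  (Pi.evalAlgHom ℝ (fun _ : β → M => ℝ) b).comp (S.defAlgebra C β).val

/-- The type `tp(b/C)`: the ideal of all `C`-definable predicates vanishing at `b`. -/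
def tp (S : MetricStructure L M) (C : Set M) {β : Type} [Countable β] (b : β → M) :
    S.TypeSpace C β where
  asIdeal := RingHom.ker (S.evalHom C b)
  isMaximal := RingHom.ker_isMaximal_of_surjective _
    fun r => ⟨algebraMap ℝ _ r, (S.evalHom C b).commutes r⟩

/-- A structure is `∅`-saturated if every type over the empty set in countably many variables is
realized. -/
def IsEmptySaturated (S : MetricStructure L M) : Prop :=
  ∀ (β : Type) [Countable β] (p : S.TypeSpace ∅ β), ∃ b : β → M, S.tp ∅ b = p

/-- The ideal (or type) `p` is approximately finitely realized in the subset `D`. -/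
def ApproxFinRealized (S : MetricStructure L M) {C : Set M} {β : Type} [Countable β]
    (p : S.TypeSpace C β) (D : Set M) : Prop :=
  ∀ ε > 0, ∀ F : Finset (S.defAlgebra C β), (∀ h ∈ F, h ∈ p.asIdeal) →
    ∃ b : β → M, (∀ j, b j ∈ D) ∧ ∀ h ∈ F, |(h : (β → M) → ℝ) b| < ε

theorem isUnit_of_le {S : MetricStructure L M} {C : Set M} {β : Type} [Countable β]
    (h : S.defAlgebra C β) {ε : ℝ} (hε : 0 < ε)
    (hh : ∀ b, ε ≤ |(h : (β → M) → ℝ) b|) : IsUnit h := by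
  have hc : Continuous fun t : ℝ => t / max (t ^ 2) (ε ^ 2) := by
    refine Continuous.div (by fun_prop) (by fun_prop) fun t => ?_
    have : 0 < ε ^ 2 := by positivity
    exact (lt_max_of_lt_right this).ne'
  have hk : S.IsDefinableOver C
      (fun b => (h : (β → M) → ℝ) b / max ((h : (β → M) → ℝ) b ^ 2) (ε ^ 2)) :=
    IsDefinableOver.comp₂ (u := fun s _ => s / max (s ^ 2) (ε ^ 2)) h.2 h.2
      (hc.comp continuous_fst)
  refine IsUnit.of_mul_eq_one (⟨_, hk⟩ : S.defAlgebra C β) ?_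
  ext b
  have h1 := hh b
  have h2 : ε ^ 2 ≤ (h : (β → M) → ℝ) b ^ 2 := by
    rw [← sq_abs ((h : (β → M) → ℝ) b)]; gcongr
  have h3 : (h : (β → M) → ℝ) b ≠ 0 := by
    intro h0; rw [h0, abs_zero] at h1; linarith
  simp only [MulMemClass.coe_mul, Pi.mul_apply, max_eq_left h2, OneMemClass.coe_one, Pi.one_apply]
  field_simp

theorem approxFinRealized_univ {S : MetricStructure L M} {C : Set M} {β : Type} [Countable β]
    (p : S.TypeSpace C β) : S.ApproxFinRealized p Set.univ := by
  intro ε hε F hF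
  by_contra! hcon
  have hmem : ∑ h ∈ F, h * h ∈ p.asIdeal :=
    Ideal.sum_mem _ fun h hh => Ideal.mul_mem_left _ _ (hF h hh)
  refine p.isMaximal.ne_top (Ideal.eq_top_of_isUnit_mem _ hmem
    (isUnit_of_le _ (ε := ε ^ 2) (by positivity) fun b => ?_))
  obtain ⟨h, hh, hb⟩ := hcon b (fun _ => trivial)
  have e : ((∑ h ∈ F, h * h : S.defAlgebra C β) : (β → M) → ℝ) b
      = ∑ h ∈ F, ((h : (β → M) → ℝ) b) ^ 2 := by
    simp [Finset.sum_apply, sq]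
  rw [e]
  refine le_trans ?_ (le_abs_self _)
  refine le_trans ?_ (Finset.single_le_sum (f := fun h : S.defAlgebra C β =>
    ((h : (β → M) → ℝ) b) ^ 2) (fun _ _ => sq_nonneg _) hh)
  rw [← sq_abs ((h : (β → M) → ℝ) b)]
  gcongr

theorem exists_value {S : MetricStructure L M} {C : Set M} {β : Type} [Countable β]
    (p : S.TypeSpace C β) (h : S.defAlgebra C β) :
    ∃! r : ℝ, h - algebraMap ℝ (S.defAlgebra C β) r ∈ p.asIdeal := by
  refine existsUnique_of_exists_of_unique ?_ ?_
  · by_contra! hcon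
    have hinv := fun r => p.isMaximal.exists_inv (hcon r)
    choose k g hg hkg using hinv
    obtain ⟨K, hK⟩ := h.2.bounded
    choose B hB using fun r => (k r).2.bounded
    have hδ : ∀ r, 0 < 1 / (2 * (|B r| + 1)) := fun r => by positivity
    obtain ⟨T, -, hT⟩ := (isCompact_Icc (a := -K) (b := K)).elim_nhds_subcover
      (fun r => Metric.ball r (1 / (2 * (|B r| + 1)))) fun r _ => Metric.ball_mem_nhds _ (hδ r)
    classical
    obtain ⟨b, -, hb⟩ := approxFinRealized_univ p (1 / 2) (by norm_num) (T.image g)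
      (by intro x hx; obtain ⟨r, -, rfl⟩ := Finset.mem_image.1 hx; exact hg r)
    have hmem := hT (abs_le.1 (hK b) : (h : (β → M) → ℝ) b ∈ Set.Icc (-K) K)
    obtain ⟨r, hr, hball⟩ := Set.mem_iUnion₂.1 hmem
    have h1 := hb _ (Finset.mem_image_of_mem g hr)
    have h2 : (k r : (β → M) → ℝ) b * ((h : (β → M) → ℝ) b - r) + (g r : (β → M) → ℝ) b = 1 := by
      have := congrArg (fun z : S.defAlgebra C β => (z : (β → M) → ℝ) b) (hkg r)
      simpa using this
    rw [Metric.mem_ball, Real.dist_eq] at hball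
    have h3 : |(k r : (β → M) → ℝ) b * ((h : (β → M) → ℝ) b - r)| < 1 / 2 + 0 := by
      rw [abs_mul]
      have hBr : |(k r : (β → M) → ℝ) b| ≤ |B r| := (hB r b).trans (le_abs_self _)
      have hp : 0 < |B r| + 1 := by positivity
      calc |(k r : (β → M) → ℝ) b| * |(h : (β → M) → ℝ) b - r|
          ≤ |B r| * |(h : (β → M) → ℝ) b - r| := by gcongr
        _ ≤ |B r| * (1 / (2 * (|B r| + 1))) := by gcongr
        _ < (|B r| + 1) * (1 / (2 * (|B r| + 1))) := by
          have := hδ r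
          nlinarith
        _ = 1 / 2 + 0 := by field_simp; ring
    have h4 := abs_lt.1 h1
    have h5 := abs_lt.1 h3
    linarith [h4.2, h5.2]
  · intro r s hr hs
    by_contra hne
    have hd := p.asIdeal.sub_mem hs hr
    have e : h - algebraMap ℝ (S.defAlgebra C β) s - (h - algebraMap ℝ (S.defAlgebra C β) r)
        = algebraMap ℝ (S.defAlgebra C β) (r - s) := by rw [map_sub]; ring
    rw [e] at hd
    exact p.isMaximal.ne_top (Ideal.eq_top_of_isUnit_mem _ hd
      ((IsUnit.mk0 _ (sub_ne_zero.2 hne)).map _))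

/-- The value at a type `p` of the continuous extension of a `C`-definable predicate `h` to the
type space: the unique real `r` with `h - r ∈ p`. -/
noncomputable def value {S : MetricStructure L M} {C : Set M} {β : Type} [Countable β]
    (p : S.TypeSpace C β) (h : S.defAlgebra C β) : ℝ :=
  (exists_value p h).choose

/-- A definable predicate without parameters, seen as a `C`-definable predicate. -/
def DefPred.over {S : MetricStructure L M} {β : Type} [Countable β] (h : S.DefPred β)
    (C : Set M) : S.defAlgebra C β :=
  ⟨h, h.definable.over C⟩

/-- The `M`-definable predicate `f_a : b ↦ f(a, b)` of a formula `f(x, y)`. -/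
def DefPred.slice {S : MetricStructure L M} {α β : Type} [Countable β] (f : S.DefPred (α ⊕ β))
    (a : α → M) : S.defAlgebra Set.univ β :=
  ⟨fun b => f (Sum.elim a b), α, f, a, fun _ => trivial, fun _ => rfl⟩

/-- The distance `d(x, y) = sup_i 2^{-i} d(x_i, y_i)` on a countable power of `M`; the position of
the variable `i` in the enumeration of `α` is `Encodable.encode i`. -/
noncomputable def powDist {α : Type} [Encodable α] (x y : α → M) : ℝ :=
  ⨆ i : α, (1 / 2 : ℝ) ^ Encodable.encode i * dist (x i) (y i)

open Classical in
/-- The distance function `P_A(x) = d(x, A) = inf_{a ∈ A} d(x, a)`, with the convention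
`P_∅ = 1`. -/
noncomputable def distTo {α : Type} [Encodable α] (A : Set (α → M)) (x : α → M) : ℝ :=
  if A.Nonempty then ⨅ a : A, powDist x a else 1

/-- A closed subset of `M^α` is definable if its distance function is a definable predicate. -/
structure IsDefinableSet (S : MetricStructure L M) {α : Type} [Encodable α]
    (A : Set (α → M)) : Prop where
  closed : IsClosed A
  definable : S.IsDefinable (distTo A)

/-- The definable predicate `P_A` of a definable set `A`. -/
noncomputable def IsDefinableSet.distPred {S : MetricStructure L M} {α : Type} [Encodable α]
    {A : Set (α → M)} (hA : S.IsDefinableSet A) : S.DefPred α :=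
  ⟨distTo A, hA.definable⟩

/-- A sequence of tuples is indiscernible if, for every `k`, all its increasing `k`-subtuples have
the same type over the empty set. -/
def IsIndiscernible (S : MetricStructure L M) {α : Type} [Countable α] (a : ℕ → α → M) : Prop :=
  ∀ (k : ℕ) (i : Fin k → ℕ), StrictMono i →
    S.tp ∅ (fun z : Fin k × α => a (i z.1) z.2) = S.tp ∅ (fun z : Fin k × α => a z.1 z.2)

/-- An elementary extension of `S`: a structure `N` in the same signature containing `M` as a
metric subspace (through `emb`), whose basic predicates extend those of `M`, and such that every
type over `M` of `N` in countably many variables is approximately finitely realized in `M`. -/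
structure ElementaryExtension (S : MetricStructure L M) where
  carrier : Type u
  [metricSpace : MetricSpace carrier]
  str : MetricStructure L carrier
  emb : M → carrier
  isometry : Isometry emb
  pred_emb : ∀ (i : L.Idx) (x : Fin (L.arity i) → M), str.pred i (emb ∘ x) = S.pred i x
  elementary : ∀ (β : Type) [Countable β] (p : str.TypeSpace (Set.range emb) β),
    str.ApproxFinRealized p (Set.range emb)

attribute [instance] ElementaryExtension.metricSpace

namespace ElementaryExtension

variable {S : MetricStructure L M}

theorem exists_near (E : S.ElementaryExtension) {β : Type} [Countable β]
    {h : (β → E.carrier) → ℝ} (hh : E.str.IsDefinableOver (Set.range E.emb) h)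
    (b : β → E.carrier) {ε : ℝ} (hε : 0 < ε) :
    ∃ m : β → M, |h (E.emb ∘ m) - h b| < ε := by
  obtain ⟨c, hc, hlt⟩ := E.elementary β (E.str.tp (Set.range E.emb) b) ε hε
    {(⟨h, hh⟩ : E.str.defAlgebra (Set.range E.emb) β) - algebraMap ℝ _ (h b)} (by
      intro k hk
      rw [Finset.mem_singleton.1 hk]
      simp [tp, evalHom])
  choose m hm using hc
  refine ⟨m, ?_⟩
  have e : E.emb ∘ m = c := funext hm
  rw [e]
  simpa using hlt _ (Finset.mem_singleton_self _)

theorem ext_of_emb (E : S.ElementaryExtension) {α : Type} {g g' : (α → E.carrier) → ℝ}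
    (hg : E.str.IsDefinable g) (hg' : E.str.IsDefinable g')
    (h : ∀ x : α → M, g (E.emb ∘ x) = g' (E.emb ∘ x)) : g = g' := by
  have := hg.countable
  funext b
  by_contra hne
  obtain ⟨m, hm⟩ := E.exists_near (h := fun y => g y - g' y)
    ((hg.over _).comp₂ (hg'.over _) (u := fun s t => s - t) (by fun_prop)) b
    (abs_pos.2 (sub_ne_zero.2 hne))
  simp [h m, abs_sub_comm] at hm

theorem exists_near_one (E : S.ElementaryExtension) {α : Type}
    {g : (Option α → E.carrier) → ℝ} (hg : E.str.IsDefinable g) (x : α → M) (n : E.carrier)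
    {ε : ℝ} (hε : 0 < ε) :
    ∃ m : M, |g (fun o => o.elim (E.emb m) (E.emb ∘ x)) - g (fun o => o.elim n (E.emb ∘ x))|
      < ε := by
  have := hg.countable
  have : Countable α := (Option.some_injective α).countable
  obtain ⟨m, hm⟩ := E.exists_near (β := Unit)
    (h := fun b => g (fun o => o.elim (b ()) (E.emb ∘ x)))
    ⟨α, ⟨_, hg.rename (γ := α ⊕ Unit) (fun o => o.elim (Sum.inr ()) Sum.inl)⟩, E.emb ∘ x,
      fun i => ⟨x i, rfl⟩, fun b => by
        dsimp only
        congr 1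
        funext o
        cases o <;> rfl⟩ (fun _ => n) hε
  exact ⟨m (), hm⟩

/-- Definable predicates of `M` extend to definable predicates of an elementary extension. -/
theorem exists_extend (E : S.ElementaryExtension) {α : Type} {f : (α → M) → ℝ}
    (hf : S.IsDefinable f) :
    ∃ g : (α → E.carrier) → ℝ, E.str.IsDefinable g ∧ ∀ x, g (E.emb ∘ x) = f x := by
  have hM := S.nonempty
  have hN := E.str.nonempty
  induction hf with
  | basic i => exact ⟨_, .basic i, E.pred_emb i⟩
  | metric => exact ⟨_, .metric, fun x => E.isometry.dist_eq _ _⟩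
  | comb u hu f hf ih =>
    choose g hg hgf using ih
    exact ⟨_, .comb u hu g hg, fun x => by simp only [hgf]⟩
  | rename σ hf ih =>
    obtain ⟨g, hg, hgf⟩ := ih
    exact ⟨_, hg.rename σ, fun x => hgf (x ∘ σ)⟩
  | sup hf ih =>
    obtain ⟨g, hg, hgf⟩ := ih
    obtain ⟨K, hK⟩ := hg.bounded
    rename_i α f
    refine ⟨_, hg.sup, fun x => ?_⟩
    have e : ∀ m : M, g (fun o => o.elim (E.emb m) (E.emb ∘ x)) = f (fun o => o.elim m x) :=
      fun m => by
        rw [← hgf]; congr 1; funext o; cases o <;> rfl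
    have b1 : BddAbove (Set.range fun n => g (fun o => o.elim n (E.emb ∘ x))) :=
      ⟨K, by rintro _ ⟨n, rfl⟩; exact (abs_le.1 (hK _)).2⟩
    have b2 : BddAbove (Set.range fun m => f (fun o => o.elim m x)) :=
      ⟨K, by rintro _ ⟨n, rfl⟩; simp only [← e]; exact (abs_le.1 (hK _)).2⟩
    refine le_antisymm (ciSup_le fun n => le_of_forall_pos_lt_add fun ε hε => ?_)
      (ciSup_le fun m => ?_)
    · obtain ⟨m, hm⟩ := E.exists_near_one hg x n hε
      rw [e] at hm
      have := le_ciSup b2 m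
      linarith [(abs_lt.1 hm).1]
    · rw [← e]; exact le_ciSup b1 (E.emb m)
  | inf hf ih =>
    obtain ⟨g, hg, hgf⟩ := ih
    obtain ⟨K, hK⟩ := hg.bounded
    rename_i α f
    refine ⟨_, hg.inf, fun x => ?_⟩
    have e : ∀ m : M, g (fun o => o.elim (E.emb m) (E.emb ∘ x)) = f (fun o => o.elim m x) :=
      fun m => by
        rw [← hgf]; congr 1; funext o; cases o <;> rfl
    have b1 : BddBelow (Set.range fun n => g (fun o => o.elim n (E.emb ∘ x))) :=
      ⟨-K, by rintro _ ⟨n, rfl⟩; exact (abs_le.1 (hK _)).1⟩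
    have b2 : BddBelow (Set.range fun m => f (fun o => o.elim m x)) :=
      ⟨-K, by rintro _ ⟨n, rfl⟩; simp only [← e]; exact (abs_le.1 (hK _)).1⟩
    refine le_antisymm (le_ciInf fun m => ?_)
      (le_ciInf fun n => le_of_forall_pos_lt_add fun ε hε => ?_)
    · rw [← e]; exact ciInf_le b1 (E.emb m)
    · obtain ⟨m, hm⟩ := E.exists_near_one hg x n hε
      rw [e] at hm
      have := ciInf_le b2 m
      linarith [(abs_lt.1 hm).2]
  | lim f g hf h ih =>
    choose G hG hGf using ih
    have := (hG 0).countable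
    have hC : UniformCauchySeqOn G atTop Set.univ := by
      rw [Metric.uniformCauchySeqOn_iff]
      intro ε hε
      obtain ⟨N, hN⟩ := eventually_atTop.1
        ((Metric.tendstoUniformly_iff.1 h) (ε / 4) (by positivity))
      refine ⟨N, fun k hk l hl y _ => ?_⟩
      obtain ⟨m, hm⟩ := E.exists_near (h := fun y => G k y - G l y)
        (((hG k).over _).comp₂ ((hG l).over _) (u := fun s t => s - t) (by fun_prop)) y
        (ε := ε / 4) (by positivity)
      simp only [hGf] at hm
      have h1 := hN k hk m
      have h2 := hN l hl m
      rw [Real.dist_eq] at h1 h2 ⊢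
      rw [abs_lt] at *
      constructor <;> linarith [h1.1, h1.2, h2.1, h2.2, hm.1, hm.2]
    choose g' hg' using fun y => cauchySeq_tendsto_of_complete (hC.cauchySeq (Set.mem_univ y))
    have hlim : TendstoUniformly G g' atTop :=
      tendstoUniformlyOn_univ.1 (hC.tendstoUniformlyOn_of_tendsto fun y _ => hg' y)
    refine ⟨g', .lim G g' hG hlim, fun x => ?_⟩
    refine tendsto_nhds_unique (hg' _) ?_
    simp only [hGf]
    exact h.tendsto_at x

/-- The unique extension of a definable predicate of `M` to a definable predicate of the elementary
extension. -/
noncomputable def extend (E : S.ElementaryExtension) {α : Type} (f : S.DefPred α) :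
    E.str.DefPred α :=
  ⟨(E.exists_extend f.definable).choose, (E.exists_extend f.definable).choose_spec.1⟩

theorem extend_emb (E : S.ElementaryExtension) {α : Type} (f : S.DefPred α) (x : α → M) :
    E.extend f (E.emb ∘ x) = f x :=
  (E.exists_extend f.definable).choose_spec.2 x

end ElementaryExtension

section conditions

variable {S : MetricStructure L M} {α β : Type} [Encodable α] [Encodable β]

/-- `f(x, y)` has no independence property on `A × B`: there are no reals `r ≠ s`, sequence
`(a_i)` in `A` and family `(b_I)`, indexed by the subsets `I` of `ℕ`, of zeros of `P_B` in some
elementary extension with `f(a_i, b_I) = r` for `i ∈ I` and `f(a_i, b_I) = s` for `i ∉ I`. -/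
def LacksIP (f : S.DefPred (α ⊕ β)) (A : Set (α → M)) {B : Set (β → M)}
    (hB : S.IsDefinableSet B) : Prop :=
  ¬ ∃ r s : ℝ, r ≠ s ∧ ∃ a : ℕ → α → M, (∀ i, a i ∈ A) ∧
    ∃ (E : S.ElementaryExtension) (b : Set ℕ → β → E.carrier),
      (∀ I, E.extend hB.distPred (b I) = 0) ∧
      ∀ (i : ℕ) (I : Set ℕ),
        (i ∈ I → E.extend f (Sum.elim (E.emb ∘ a i) (b I)) = r) ∧
        (i ∉ I → E.extend f (Sum.elim (E.emb ∘ a i) (b I)) = s)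

/-- Along every indiscernible sequence of `A`, the values `f(a_i, b)` converge for all `b ∈ B`. -/
def ConvergesOnIndiscernibles (f : S.DefPred (α ⊕ β)) (A : Set (α → M)) (B : Set (β → M)) :
    Prop :=
  ∀ a : ℕ → α → M, (∀ i, a i ∈ A) → S.IsIndiscernible a → ∀ b ∈ B,
    ∃ l : ℝ, Tendsto (fun i => f (Sum.elim (a i) b)) atTop (𝓝 l)

/-- Along every indiscernible sequence of `A`, the values `f(a_i, b)` converge for all zeros `b`
of `P_B` in any elementary extension. -/
def ConvergesOnIndiscerniblesExt (f : S.DefPred (α ⊕ β)) (A : Set (α → M)) {B : Set (β → M)}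
    (hB : S.IsDefinableSet B) : Prop :=
  ∀ a : ℕ → α → M, (∀ i, a i ∈ A) → S.IsIndiscernible a →
    ∀ (E : S.ElementaryExtension) (b : β → E.carrier), E.extend hB.distPred b = 0 →
      ∃ l : ℝ, Tendsto (fun i => E.extend f (Sum.elim (E.emb ∘ a i) b)) atTop (𝓝 l)

/-- Every sequence of `A` has a subsequence along which the values `f(a_i, b)` converge for all
zeros `b` of `P_B` in any elementary extension. -/
def HasConvergentSubsequences (f : S.DefPred (α ⊕ β)) (A : Set (α → M)) {B : Set (β → M)}
    (hB : S.IsDefinableSet B) : Prop :=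
  ∀ a : ℕ → α → M, (∀ i, a i ∈ A) → ∃ φ : ℕ → ℕ, StrictMono φ ∧
    ∀ (E : S.ElementaryExtension) (b : β → E.carrier), E.extend hB.distPred b = 0 →
      ∃ l : ℝ, Tendsto (fun j => E.extend f (Sum.elim (E.emb ∘ a (φ j)) b)) atTop (𝓝 l)

/-- The set `B* = {p ∈ S_y(M) : P_B ∈ p}` of types over `M`. -/
def IsDefinableSet.typeSet {B : Set (β → M)} (hB : S.IsDefinableSet B) :
    Set (S.TypeSpace Set.univ β) :=
  {p | hB.distPred.over Set.univ ∈ p.asIdeal}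

/-- The family of the functions `f̃_a|_{B*}`, for `a ∈ A`, in `ℝ^{B*}`. -/
noncomputable def typeFunctions (f : S.DefPred (α ⊕ β)) (A : Set (α → M)) {B : Set (β → M)}
    (hB : S.IsDefinableSet B) : Set (hB.typeSet → ℝ) :=
  (fun a p => value p.1 (f.slice a)) '' A

end conditions

end MetricStructure

/-- Every sequence of elements of `s` has a subsequence that converges in `X`. -/
def IsSeqPrecompact {X : Type*} [TopologicalSpace X] (s : Set X) : Prop :=
  ∀ u : ℕ → X, (∀ n, u n ∈ s) →
    ∃ φ : ℕ → ℕ, StrictMono φ ∧ ∃ x : X, Tendsto (u ∘ φ) atTop (𝓝 x)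

end MetricModel

/-!
Everything is reduced to the *asymptotic value sequences* of a sequence `(a_i)` in `A`: the real
sequences `w` such that finite pieces of `w` are approximated by the values `f(a_i, m)` for a tuple
`m` with `P_B(m)` small (`IsAsymptoticValue`). They are the value sequences at the types in `B*`,
and also those at the zeros of `P_B` in elementary extensions. For the latter a single elementary
extension suffices, the ultrapower `ultrapowerExtension` along a nonprincipal ultrafilter on `ℕ`,
whose definable predicates are computed by Łoś's theorem (`IsDefinable.exists_isUltralimit`). Hence
the independence property says that all sequences with two prescribed values `r ≠ s` are asymptotic
value sequences of some `(a_i)` (`lacksIP_iff`). By `∅`-saturation, an asymptotic value sequence is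
even realized in the structure itself, if `(a_i)` may be replaced by a sequence of the same type.

The implications are then as follows. If `(a_i)` is indiscernible and `f(a_i, b)` does not converge,
then it has two limit values `r ≠ s`. Every finite pattern of `r` and `s` occurs at `b` along some
increasing tuple of indices, and then up to small errors along the initial indices as well, at some
other tuple, as the quality of the best approximation of a pattern is a definable predicate
(`patternInf`). This gives the independence property. Saturation carries convergence on `B` over to elementary extensions.

For the passage from indiscernible to arbitrary sequences `(a_i)`, the iterated products of a
nonprincipal ultrafilter with itself play the part of Ramsey's theorem. The limit of the types of
`(a_{t 0}, a_{t 1}, …)` along them is the type of an indiscernible sequence, which is realized by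
saturation. Convergence and compactness bound the length of the oscillations of `f(·, y)` between
two rationals along the latter, and this bound is an open condition on finite tuples. So it holds
for generic tuples of the original sequence, and a generic subsequence
(`exists_generic_subsequence`) satisfies it for all pairs of rationals. Along such a subsequence the
asymptotic value sequences converge.

Finally, an independent sequence has no convergent subsequence, as some type takes the two values
alternately along it. By uniform continuity this persists for uniform approximations of the sequence
by elements of a dense subset.
-/

namespace MetricModel

/-! ### Limits of bounded real functions along ultrafilters -/

theorem exists_tendsto_of_bounded {J : Type*} (Φ : Ultrafilter J) {g : J → ℝ}
    (hg : ∃ K : ℝ, ∀ j, |g j| ≤ K) : ∃ l, Tendsto g Φ (𝓝 l) := by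
  obtain ⟨K, hK⟩ := hg
  obtain ⟨l, -, hl⟩ := (isCompact_Icc (a := -K) (b := K)).ultrafilter_le_nhds (Φ.map g)
    (by
      rw [le_principal_iff]
      exact Eventually.of_forall (f := (Φ : Filter J)) fun j => abs_le.1 (hK j))
  exact ⟨l, hl⟩

namespace MetricStructure

universe u v

variable {L : Signature.{v}} {M : Type u} [MetricSpace M] {S : MetricStructure L M}

/-! ### Types: values, limits, realizations -/

section types

variable {C : Set M} {β : Type} [Countable β]

theorem value_spec (p : S.TypeSpace C β) (h : S.defAlgebra C β) :
    h - algebraMap ℝ _ (value p h) ∈ p.asIdeal :=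
  (exists_value p h).choose_spec.1

theorem value_eq_iff (p : S.TypeSpace C β) (h : S.defAlgebra C β) (r : ℝ) :
    value p h = r ↔ h - algebraMap ℝ _ r ∈ p.asIdeal := by
  refine ⟨fun e => e ▸ value_spec p h, fun hr => ?_⟩
  exact ((exists_value p h).choose_spec.2 r hr).symm

theorem mem_iff_value_eq_zero (p : S.TypeSpace C β) (h : S.defAlgebra C β) :
    h ∈ p.asIdeal ↔ value p h = 0 := by
  rw [value_eq_iff, map_zero, sub_zero]

theorem mem_tp_iff (b : β → M) (h : S.defAlgebra C β) :
    h ∈ (S.tp C b).asIdeal ↔ (h : (β → M) → ℝ) b = 0 := Iff.rfl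

theorem value_tp (b : β → M) (h : S.defAlgebra C β) :
    value (S.tp C b) h = (h : (β → M) → ℝ) b := by
  rw [value_eq_iff, mem_tp_iff]
  simp

theorem apply_eq_of_tp_eq {x y : β → M} (h : S.tp ∅ x = S.tp ∅ y) (g : S.DefPred β) :
    g x = g y := by
  have h1 := value_tp x (g.over ∅)
  rw [h, value_tp] at h1
  exact h1.symm

/-- There are no parameters in the empty set, so types over `∅` are determined by the definable
predicates. -/
theorem tp_eq_of_apply_eq {x y : β → M} (h : ∀ g : S.DefPred β, g x = g y) :
    S.tp ∅ x = S.tp ∅ y := by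
  refine MaximalSpectrum.ext (Ideal.ext fun k => ?_)
  obtain ⟨k, γ, g, c, hc, hk⟩ := k
  have : IsEmpty γ := ⟨fun i => hc i⟩
  have e : ∀ b, k b = g (b ∘ Sum.elim isEmptyElim id) := fun b => by
    rw [hk]
    congr 1
    funext z
    rcases z with i | i
    · exact isEmptyElim i
    · rfl
  rw [mem_tp_iff, mem_tp_iff]
  change k x = 0 ↔ k y = 0
  rw [e, e, h ⟨_, g.definable.rename (Sum.elim isEmptyElim id)⟩]

/-- The type over `C` to which the types of the tuples `x j` converge along an ultrafilter. -/
theorem exists_limit_type (C : Set M) {J : Type*} (Φ : Ultrafilter J) (x : J → β → M) :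
    ∃ p : S.TypeSpace C β, ∀ h : S.defAlgebra C β,
      Tendsto (fun j => (h : (β → M) → ℝ) (x j)) Φ (𝓝 (value p h)) := by
  have hex : ∀ h : S.defAlgebra C β, ∃ l, Tendsto (fun j => (h : (β → M) → ℝ) (x j)) Φ (𝓝 l) :=
    fun h => exists_tendsto_of_bounded Φ (h.2.bounded.imp fun K hK j => hK _)
  choose l hl using hex
  let χ : S.defAlgebra C β →+* ℝ :=
    { toFun := l
      map_one' := tendsto_nhds_unique (hl 1) tendsto_const_nhds
      map_zero' := tendsto_nhds_unique (hl 0) tendsto_const_nhds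
      map_mul' := fun g h => tendsto_nhds_unique (hl (g * h)) ((hl g).mul (hl h))
      map_add' := fun g h => tendsto_nhds_unique (hl (g + h)) ((hl g).add (hl h)) }
  have hχ : ∀ r, χ (algebraMap ℝ _ r) = r := fun r =>
    tendsto_nhds_unique (hl (algebraMap ℝ _ r)) tendsto_const_nhds
  refine ⟨⟨RingHom.ker χ, RingHom.ker_isMaximal_of_surjective _ fun r => ⟨_, hχ r⟩⟩, fun h => ?_⟩
  have e : value (⟨RingHom.ker χ, RingHom.ker_isMaximal_of_surjective _ fun r => ⟨_, hχ r⟩⟩ :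
      S.TypeSpace C β) h = l h := by
    rw [value_eq_iff, RingHom.mem_ker, map_sub, hχ]
    exact sub_self _
  rw [e]
  exact hl h

/-- In a `∅`-saturated structure, the limit type over `∅` along an ultrafilter is realized. -/
theorem IsEmptySaturated.exists_limit (hS : S.IsEmptySaturated) {J : Type*} (Φ : Ultrafilter J)
    (x : J → β → M) :
    ∃ c : β → M, ∀ h : S.DefPred β, Tendsto (fun j => h (x j)) Φ (𝓝 (h c)) := by
  obtain ⟨p, hp⟩ := exists_limit_type (S := S) ∅ Φ x
  obtain ⟨c, rfl⟩ := hS β p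
  refine ⟨c, fun h => ?_⟩
  have := hp (h.over ∅)
  rw [value_tp] at this
  exact this

end types

/-! ### Distance to a definable set -/

section dist

variable {α : Type} [Encodable α]

theorem powDist_nonneg (x y : α → M) : 0 ≤ powDist x y :=
  Real.iSup_nonneg fun _ => by positivity

theorem powDist_self (x : α → M) : powDist x x = 0 := by
  simp [powDist]

theorem le_powDist (S : MetricStructure L M) (x y : α → M) (i : α) :
    (1 / 2 : ℝ) ^ Encodable.encode i * dist (x i) (y i) ≤ powDist x y := by
  obtain ⟨D, hD⟩ := S.bounded
  refine le_ciSup (f := fun i : α => (1 / 2 : ℝ) ^ Encodable.encode i * dist (x i) (y i)) ⟨D, ?_⟩ i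
  rintro _ ⟨i, rfl⟩
  calc (1 / 2 : ℝ) ^ Encodable.encode i * dist (x i) (y i)
      ≤ 1 * dist (x i) (y i) := by
        gcongr
        exact pow_le_one₀ (by norm_num) (by norm_num)
    _ ≤ D := by rw [one_mul]; exact hD _ _

theorem distTo_nonneg (A : Set (α → M)) (x : α → M) : 0 ≤ distTo A x := by
  unfold distTo
  split_ifs
  · exact Real.iInf_nonneg fun _ => powDist_nonneg _ _
  · exact zero_le_one

theorem IsDefinableSet.distTo_eq_zero_iff {A : Set (α → M)} (hA : S.IsDefinableSet A)
    (x : α → M) : distTo A x = 0 ↔ x ∈ A := by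
  have hb : BddBelow (Set.range fun a : A => powDist x a) :=
    ⟨0, by rintro _ ⟨a, rfl⟩; exact powDist_nonneg _ _⟩
  constructor
  · intro h
    unfold distTo at h
    split_ifs at h with hne
    · have := hne.to_subtype
      rw [← hA.closed.closure_eq, mem_closure_iff_nhds]
      intro t ht
      rw [nhds_pi, mem_pi'] at ht
      obtain ⟨I, s, hs, hst⟩ := ht
      choose ε hε hεs using fun i => Metric.mem_nhds_iff.1 (hs i)
      have hev : ∀ i ∈ I, ∀ᶠ δ in 𝓝[>] (0 : ℝ), δ < (1 / 2 : ℝ) ^ Encodable.encode i * ε i :=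
        fun i _ => eventually_nhdsWithin_of_eventually_nhds
          (eventually_lt_nhds (by have := hε i; positivity))
      obtain ⟨δ, hδ, hδ0⟩ := (((eventually_all_finset I).2 hev).and
        self_mem_nhdsWithin).exists
      obtain ⟨a, ha⟩ := exists_lt_of_ciInf_lt (h.trans_lt hδ0)
      refine ⟨a, hst fun i hi => hεs i ?_, a.2⟩
      have h1 := (le_powDist S x a i).trans_lt (ha.trans (hδ i hi))
      rw [Metric.mem_ball, dist_comm]
      exact lt_of_mul_lt_mul_left h1 (by positivity)
    · exact absurd h one_ne_zero
  · intro hx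
    refine le_antisymm ?_ (distTo_nonneg _ _)
    unfold distTo
    rw [if_pos ⟨x, hx⟩]
    exact (ciInf_le hb ⟨x, hx⟩).trans_eq (powDist_self x)

end dist

/-! ### Definable predicates: uniform continuity and infima over countable tuples -/

section sup

variable {ι : Type*} [Nonempty ι]

theorem abs_ciSup_sub_ciSup_le {g h : ι → ℝ} {ε : ℝ} (hg : BddAbove (Set.range g))
    (hh : BddAbove (Set.range h)) (hgh : ∀ i, |g i - h i| ≤ ε) : |iSup g - iSup h| ≤ ε := by
  rw [abs_sub_le_iff]
  constructor
  · rw [sub_le_iff_le_add]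
    exact ciSup_le fun i => by linarith [(abs_le.1 (hgh i)).2, le_ciSup hh i]
  · rw [sub_le_iff_le_add]
    exact ciSup_le fun i => by linarith [(abs_le.1 (hgh i)).1, le_ciSup hg i]

theorem abs_ciInf_sub_ciInf_le {g h : ι → ℝ} {ε : ℝ} (hg : BddBelow (Set.range g))
    (hh : BddBelow (Set.range h)) (hgh : ∀ i, |g i - h i| ≤ ε) : |iInf g - iInf h| ≤ ε := by
  rw [abs_sub_le_iff]
  constructor
  · rw [sub_le_comm]
    exact le_ciInf fun i => by linarith [(abs_le.1 (hgh i)).2, ciInf_le hg i]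
  · rw [sub_le_comm]
    exact le_ciInf fun i => by linarith [(abs_le.1 (hgh i)).1, ciInf_le hh i]

end sup

variable {α β γ : Type}

theorem IsDefinable.bddAbove {f : (α → M) → ℝ} (hf : S.IsDefinable f) {ι : Sort*}
    (x : ι → α → M) : BddAbove (Set.range fun i => f (x i)) := by
  obtain ⟨K, hK⟩ := hf.bounded
  exact ⟨K, by rintro _ ⟨i, rfl⟩; exact (abs_le.1 (hK _)).2⟩

theorem IsDefinable.bddBelow {f : (α → M) → ℝ} (hf : S.IsDefinable f) {ι : Sort*}
    (x : ι → α → M) : BddBelow (Set.range fun i => f (x i)) := by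
  obtain ⟨K, hK⟩ := hf.bounded
  exact ⟨-K, by rintro _ ⟨i, rfl⟩; exact (abs_le.1 (hK _)).1⟩

/-- A continuous function of finitely many bounded functions is controlled by them uniformly. -/
theorem exists_delta_of_continuous {k : ℕ} {u : (Fin k → ℝ) → ℝ} (hu : Continuous u)
    (K : Fin k → ℝ) {ε : ℝ} (hε : 0 < ε) :
    ∃ δ > 0, ∀ s t : Fin k → ℝ, (∀ j, |s j| ≤ K j) → (∀ j, |t j| ≤ K j) →
      (∀ j, |s j - t j| < δ) → |u s - u t| < ε := by
  have hc : IsCompact (Set.pi Set.univ fun j => Set.Icc (-K j) (K j)) :=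
    isCompact_univ_pi fun j => isCompact_Icc
  have huc := hc.uniformContinuousOn_of_continuous hu.continuousOn
  obtain ⟨δ, hδ, h⟩ := Metric.uniformContinuousOn_iff.1 huc ε hε
  refine ⟨δ, hδ, fun s t hs ht hst => ?_⟩
  exact h s (fun j _ => abs_le.1 (hs j)) t (fun j _ => abs_le.1 (ht j))
    ((dist_pi_lt_iff hδ).2 hst)

theorem uniformContinuous_optionElim :
    UniformContinuous fun z : M × (α → M) => fun o : Option α => o.elim z.1 z.2 := by
  refine uniformContinuous_pi.2 fun o => ?_
  cases o with
  | none => exact uniformContinuous_fst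
  | some i => exact (Pi.uniformContinuous_proj (fun _ : α => M) i).comp uniformContinuous_snd

/-- A uniformly continuous function is uniformly continuous in its second variable, uniformly in
the first one. -/
theorem eventually_forall_abs_sub_lt {X Y : Type*} [UniformSpace X] [UniformSpace Y]
    {F : X × Y → ℝ} (hF : UniformContinuous F) {ε : ℝ} (hε : 0 < ε) :
    ∀ᶠ z : Y × Y in uniformity Y, ∀ x : X, |F (x, z.1) - F (x, z.2)| < ε := by
  have h := hF (Metric.dist_mem_uniformity hε)
  rw [mem_map, uniformity_prod_eq_comap_prod, mem_comap] at h
  obtain ⟨t, ht, hts⟩ := h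
  obtain ⟨t₁, ht₁, t₂, ht₂, h₁₂⟩ := mem_prod_iff.1 ht
  filter_upwards [ht₂] with z hz x
  exact hts (show ((x, z.1), (x, z.2)) ∈ _ from h₁₂ ⟨refl_mem_uniformity ht₁, hz⟩)

theorem uniformContinuous_of_eventually {X : Type*} [UniformSpace X] {f : X → ℝ}
    (h : ∀ ε > 0, ∀ᶠ z : X × X in uniformity X, |f z.1 - f z.2| < ε) : UniformContinuous f := by
  intro t ht
  obtain ⟨ε, hε, hεt⟩ := Metric.mem_uniformity_dist.1 ht
  exact mem_of_superset (h ε hε) fun z hz => hεt hz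

theorem IsDefinable.uniformContinuous {f : (α → M) → ℝ} (hf : S.IsDefinable f) :
    UniformContinuous f := by
  have hM := S.nonempty
  induction hf with
  | basic i => exact S.pred_unifCont i
  | metric =>
    exact uniformContinuous_dist.comp ((Pi.uniformContinuous_proj (fun _ : Fin 2 => M) 0).prodMk
      (Pi.uniformContinuous_proj (fun _ : Fin 2 => M) 1))
  | comb u hu f hf ih =>
    choose K hK using fun j => (hf j).bounded
    refine uniformContinuous_of_eventually fun ε hε => ?_
    obtain ⟨δ, hδ, h⟩ := exists_delta_of_continuous hu K hε
    filter_upwards [eventually_all.2 fun j => ih j (Metric.dist_mem_uniformity hδ)] with z hz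
    exact h _ _ (fun j => hK j _) (fun j => hK j _) hz
  | rename σ hf ih =>
    exact ih.comp (uniformContinuous_pi.2 fun i => Pi.uniformContinuous_proj _ (σ i))
  | sup hf ih =>
    rename_i α f
    refine uniformContinuous_of_eventually fun ε hε => ?_
    filter_upwards [eventually_forall_abs_sub_lt
      (ih.comp uniformContinuous_optionElim) (half_pos hε)] with z hz
    refine lt_of_le_of_lt ?_ (half_lt_self hε)
    exact abs_ciSup_sub_ciSup_le (hf.bddAbove _) (hf.bddAbove _) fun m => (hz m).le
  | inf hf ih =>
    rename_i α f
    refine uniformContinuous_of_eventually fun ε hε => ?_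
    filter_upwards [eventually_forall_abs_sub_lt
      (ih.comp uniformContinuous_optionElim) (half_pos hε)] with z hz
    refine lt_of_le_of_lt ?_ (half_lt_self hε)
    exact abs_ciInf_sub_ciInf_le (hf.bddBelow _) (hf.bddBelow _) fun m => (hz m).le
  | lim f g hf h ih =>
    exact h.uniformContinuous (Eventually.frequently (Eventually.of_forall ih))

/-- A function that is uniformly approximated by definable predicates is definable. -/
theorem isDefinable_of_forall_approx {f : (α → M) → ℝ}
    (h : ∀ ε > 0, ∃ g, S.IsDefinable g ∧ ∀ x, |f x - g x| ≤ ε) : S.IsDefinable f := by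
  choose g hg hgf using fun n : ℕ => h (1 / (n + 1)) Nat.one_div_pos_of_nat
  refine .lim g f hg (Metric.tendstoUniformly_iff.2 fun ε hε => ?_)
  filter_upwards [tendsto_one_div_add_atTop_nhds_zero_nat.eventually (gt_mem_nhds hε)] with n hn x
  exact (hgf n x).trans_lt hn

/-- A definable predicate is uniformly approximated by definable predicates in finitely many of its
variables. -/
theorem IsDefinable.exists_finite_approx {f : (α → M) → ℝ} (hf : S.IsDefinable f) :
    ∀ ε > 0, ∃ (T : Finset α) (g : (T → M) → ℝ), S.IsDefinable g ∧
      ∀ x, |f x - g (fun i => x i)| ≤ ε := by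
  classical
  have hM := S.nonempty
  induction hf with
  | basic i =>
    refine fun ε hε => ⟨Finset.univ, _, (IsDefinable.basic i).rename
      (fun j => ⟨j, Finset.mem_univ j⟩), fun x => ?_⟩
    simpa [Function.comp_def] using hε.le
  | metric =>
    refine fun ε hε => ⟨Finset.univ, _, IsDefinable.metric.rename
      (fun j => ⟨j, Finset.mem_univ j⟩), fun x => ?_⟩
    simpa [Function.comp_def] using hε.le
  | comb u hu f hf ih =>
    intro ε hε
    choose K hK using fun j => (hf j).bounded
    obtain ⟨δ, hδ, h⟩ := exists_delta_of_continuous hu (fun j => K j + 1) hε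
    have hδ' : 0 < min (δ / 2) 1 := by positivity
    choose T g hg hfg using fun j => ih j _ hδ'
    refine ⟨Finset.univ.biUnion T, _, .comb u hu _ fun j => (hg j).rename (fun i =>
      ⟨i, Finset.mem_biUnion.2 ⟨j, Finset.mem_univ j, i.2⟩⟩), fun x => ?_⟩
    refine (h _ _ (fun j => ?_) (fun j => ?_) fun j => ?_).le
    · linarith [hK j x]
    · have h1 := abs_le.1 ((hfg j x).trans (min_le_right _ _))
      have h2 := abs_le.1 (hK j x)
      rw [abs_le]
      simp only [Function.comp_def]
      constructor <;> linarith [h1.1, h1.2, h2.1, h2.2]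
    · have := (hfg j x).trans (min_le_left _ _)
      simp only [Function.comp_def]
      linarith
  | rename σ hf ih =>
    intro ε hε
    obtain ⟨T, g, hg, hfg⟩ := ih ε hε
    exact ⟨T.image σ, _, hg.rename (fun i => ⟨σ i, Finset.mem_image_of_mem σ i.2⟩),
      fun x => hfg _⟩
  | sup hf ih =>
    intro ε hε
    obtain ⟨T, g, hg, hfg⟩ := ih ε hε
    have hg' := hg.rename (γ := Option (T.eraseNone)) (fun i => match i with
      | ⟨none, _⟩ => none
      | ⟨some i, hi⟩ => some ⟨i, Finset.mem_eraseNone.2 hi⟩)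
    refine ⟨T.eraseNone, _, hg'.sup, fun x => ?_⟩
    refine abs_ciSup_sub_ciSup_le (hf.bddAbove _) (hg'.bddAbove _) fun m => ?_
    convert hfg _ using 4
    ext ⟨(_ | i), hi⟩ <;> rfl
  | inf hf ih =>
    intro ε hε
    obtain ⟨T, g, hg, hfg⟩ := ih ε hε
    have hg' := hg.rename (γ := Option (T.eraseNone)) (fun i => match i with
      | ⟨none, _⟩ => none
      | ⟨some i, hi⟩ => some ⟨i, Finset.mem_eraseNone.2 hi⟩)
    refine ⟨T.eraseNone, _, hg'.inf, fun x => ?_⟩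
    refine abs_ciInf_sub_ciInf_le (hf.bddBelow _) (hg'.bddBelow _) fun m => ?_
    convert hfg _ using 4
    ext ⟨(_ | i), hi⟩ <;> rfl
  | lim f g hf h ih =>
    intro ε hε
    obtain ⟨n, hn⟩ := ((Metric.tendstoUniformly_iff.1 h) (ε / 2) (by positivity)).exists
    obtain ⟨T, k, hk, hfk⟩ := ih n (ε / 2) (by positivity)
    refine ⟨T, k, hk, fun x => ?_⟩
    have h1 := (hn x).le
    rw [Real.dist_eq] at h1
    calc |g x - k fun i => x i| = |(g x - f n x) + (f n x - k fun i => x i)| := by ring_nf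
      _ ≤ _ := abs_add_le _ _
      _ ≤ ε := by linarith [hfk x]

/-- Infima over finitely many variables, one variable at a time. -/
theorem IsDefinable.iInf_finite [Finite β] {f : (γ ⊕ β → M) → ℝ} (hf : S.IsDefinable f) :
    S.IsDefinable fun x : γ → M => ⨅ y : β → M, f (Sum.elim x y) := by
  have hM := S.nonempty
  revert γ f
  refine @Finite.induction_empty_option (fun β => ∀ {γ : Type} {f : (γ ⊕ β → M) → ℝ},
    S.IsDefinable f → S.IsDefinable fun x : γ → M => ⨅ y : β → M, f (Sum.elim x y)) ?_ ?_ ?_ β _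
  · intro β β' e ih γ f hf
    have := hf.countable
    have : Countable γ := (Sum.inl_injective (β := β')).countable
    have : Countable β' := (Sum.inr_injective (α := γ)).countable
    have : Countable β := e.injective.countable
    have h := ih (hf.rename (γ := γ ⊕ β) (Sum.map id e.symm))
    convert h using 2 with x
    refine Equiv.iInf_congr (e.arrowCongr (Equiv.refl M)).symm fun y => ?_
    congr 1
    ext (i | i) <;> simp
  · intro γ f hf
    have := hf.countable
    have : Countable γ := (Sum.inl_injective (β := PEmpty)).countable
    convert hf.rename (γ := γ) (Sum.elim id PEmpty.elim) using 2 with x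
    rw [ciInf_unique]
    congr 1
    ext (i | i)
    · rfl
    · exact i.elim
  · intro β _ ih γ f hf
    have := hf.countable
    have : Countable γ := (Sum.inl_injective (β := Option β)).countable
    have hf' := hf.rename (γ := Option γ ⊕ β)
      (Sum.elim (fun i => Sum.inl (some i)) (fun o => o.elim (Sum.inl none) Sum.inr))
    convert (ih hf').inf using 2 with x
    refine le_antisymm (le_ciInf fun m => le_ciInf fun y => ?_) (le_ciInf fun y => ?_)
    · refine (ciInf_le (hf.bddBelow _) (fun o => o.elim m y)).trans_eq ?_
      congr 1
      ext (i | (_ | i)) <;> rfl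
    · refine (ciInf_le ?_ (y none)).trans ((ciInf_le (hf'.bddBelow _) (y ∘ some)).trans_eq ?_)
      · exact (ih hf').bddBelow _
      · congr 1
        ext (i | (_ | i)) <;> rfl

/-- Infima over countable tuples preserve definability, although only infima over one variable are
basic operations: up to a uniformly small error, only finitely many variables matter. -/
theorem IsDefinable.iInf {f : (γ ⊕ β → M) → ℝ} (hf : S.IsDefinable f) :
    S.IsDefinable fun x : γ → M => ⨅ y : β → M, f (Sum.elim x y) := by
  classical
  have hM := S.nonempty
  have := hf.countable
  have : Countable γ := (Sum.inl_injective (β := β)).countable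
  refine isDefinable_of_forall_approx fun ε hε => ?_
  obtain ⟨T, g, hg, hfg⟩ := hf.exists_finite_approx ε hε
  have hg' := hg.rename (γ := γ ⊕ T.toRight) (fun i => match i with
      | ⟨Sum.inl i, _⟩ => Sum.inl i
      | ⟨Sum.inr i, hi⟩ => Sum.inr ⟨i, Finset.mem_toRight.2 hi⟩)
  refine ⟨_, hg'.iInf_finite, fun x => ?_⟩
  have hsurj : Function.Surjective fun (y : β → M) (i : T.toRight) => y i :=
    fun z => ⟨fun i => if h : i ∈ T.toRight then z ⟨i, h⟩ else Classical.arbitrary M, by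
      ext i; simp [i.2]⟩
  rw [← hsurj.iInf_comp]
  refine abs_ciInf_sub_ciInf_le (hf.bddBelow _) (hg'.bddBelow _) fun y => ?_
  convert hfg _ using 4
  ext ⟨(i | i), hi⟩ <;> rfl

end MetricStructure

/-! ### The ultrapower along a nonprincipal ultrafilter on `ℕ` -/

theorem eventually_hyperfilter_ge (m : ℕ) : ∀ᶠ n in (hyperfilter ℕ : Filter ℕ), m ≤ n :=
  (Nat.hyperfilter_le_atTop : (hyperfilter ℕ : Filter ℕ) ≤ atTop) (eventually_ge_atTop m)

theorem optionElim_apply {α X : Type*} (x : α → ℕ → X) (y : ℕ → X) (n : ℕ) :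
    (fun o : Option α => (o.elim y x : ℕ → X) n) = fun o => o.elim (y n) fun i => x i n := by
  ext (_ | i) <;> rfl

theorem real_iInf_eq_neg_iSup_neg {ι : Sort*} (f : ι → ℝ) : ⨅ i, f i = -⨆ i, -f i := by
  rw [iInf, Real.sInf_def, iSup]
  congr 2
  ext r
  simp [neg_eq_iff_eq_neg]

/-- Countable saturation of ultraproducts along a nonprincipal ultrafilter on `ℕ`: at the
coordinate `n`, satisfy as many of the first `n` conditions as possible. -/
theorem exists_forall_eventually_hyperfilter {X : Type*} [Nonempty X] (P : ℕ → ℕ → X → Prop)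
    (h : ∀ K, ∀ᶠ n in (hyperfilter ℕ : Filter ℕ), ∃ y, ∀ k < K, P k n y) :
    ∃ y : ℕ → X, ∀ k, ∀ᶠ n in (hyperfilter ℕ : Filter ℕ), P k n (y n) := by
  classical
  have h0 : ∀ n, ∃ y, ∀ k < Nat.findGreatest (fun K => ∃ y, ∀ k < K, P k n y) n, P k n y :=
    fun n => Nat.findGreatest_spec (P := fun K => ∃ y, ∀ k < K, P k n y) (Nat.zero_le n)
      ⟨Classical.arbitrary X, fun k hk => absurd hk (Nat.not_lt_zero k)⟩
  choose y hy using h0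
  refine ⟨y, fun k => ?_⟩
  filter_upwards [h (k + 1), eventually_hyperfilter_ge (k + 1)] with n hn hkn
  exact hy n k (Nat.le_findGreatest hkn hn)

namespace MetricStructure

universe u v

variable {L : Signature.{v}} {M : Type u} [MetricSpace M]

/-- Sequences in a metric structure, with the pseudometric given by the limit of the distances
along the nonprincipal ultrafilter `hyperfilter ℕ`. -/
def UltraSeq (_S : MetricStructure L M) : Type u := ℕ → M

theorem exists_tendsto_dist (S : MetricStructure L M) (x y : ℕ → M) :
    ∃ l, Tendsto (fun n => dist (x n) (y n)) (hyperfilter ℕ) (𝓝 l) := by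
  obtain ⟨D, hD⟩ := S.bounded
  exact exists_tendsto_of_bounded _ ⟨D, fun n => by rw [abs_of_nonneg dist_nonneg]; exact hD _ _⟩

noncomputable instance (S : MetricStructure L M) : PseudoMetricSpace S.UltraSeq where
  dist x y := (S.exists_tendsto_dist x y).choose
  dist_self x := tendsto_nhds_unique (S.exists_tendsto_dist x x).choose_spec
    (by simp only [dist_self]; exact tendsto_const_nhds)
  dist_comm x y := tendsto_nhds_unique (S.exists_tendsto_dist x y).choose_spec
    (by simp only [dist_comm (x _)]; exact (S.exists_tendsto_dist y x).choose_spec)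
  dist_triangle x y z := le_of_tendsto_of_tendsto' (S.exists_tendsto_dist x z).choose_spec
    ((S.exists_tendsto_dist x y).choose_spec.add (S.exists_tendsto_dist y z).choose_spec)
    fun n => dist_triangle _ _ _

theorem UltraSeq.tendsto_dist {S : MetricStructure L M} (x y : S.UltraSeq) :
    Tendsto (fun n => dist (x n) (y n)) (hyperfilter ℕ) (𝓝 (dist x y)) :=
  (S.exists_tendsto_dist x y).choose_spec

instance (S : MetricStructure L M) : CompleteSpace S.UltraSeq := by
  have := S.nonempty
  refine Metric.complete_of_convergent_controlled_sequences (fun n => (1 / 2) ^ n)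
    (fun n => by positivity) fun x hx => ?_
  obtain ⟨y, hy⟩ := exists_forall_eventually_hyperfilter
    (fun k n y => dist (x k n) y ≤ (1 / 2 : ℝ) ^ k) (fun K => by
      have h : ∀ k ∈ Finset.range K, ∀ᶠ n in (hyperfilter ℕ : Filter ℕ),
          dist (x k n) (x K n) < (1 / 2 : ℝ) ^ k := fun k hk =>
        (UltraSeq.tendsto_dist (x k) (x K)).eventually
          (gt_mem_nhds (hx k k K le_rfl (Finset.mem_range.1 hk).le))
      filter_upwards [(eventually_all_finset _).2 h] with n hn
      exact ⟨x K n, fun k hk => (hn k (Finset.mem_range.2 hk)).le⟩)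
  refine ⟨(y : S.UltraSeq), tendsto_iff_dist_tendsto_zero.2 ?_⟩
  exact squeeze_zero (fun k => dist_nonneg)
    (fun k => le_of_tendsto (UltraSeq.tendsto_dist (x k) y) (hy k))
    (tendsto_pow_atTop_nhds_zero_of_lt_one (by norm_num) (by norm_num))

/-- The underlying metric space of the ultrapower of a metric structure along
`hyperfilter ℕ`. -/
abbrev Ultrapower (S : MetricStructure L M) : Type u := SeparationQuotient S.UltraSeq

/-- The class of a sequence in the ultrapower. -/
noncomputable def Ultrapower.mk (S : MetricStructure L M) (x : ℕ → M) : S.Ultrapower :=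
  SeparationQuotient.mk (X := S.UltraSeq) x

theorem Ultrapower.exists_mk {S : MetricStructure L M} {α : Type*} (X : α → S.Ultrapower) :
    ∃ x : α → ℕ → M, X = fun i => mk S (x i) := by
  choose x hx using fun i => SeparationQuotient.surjective_mk (X i)
  exact ⟨x, funext fun i => (hx i).symm⟩

theorem Ultrapower.tendsto_dist {S : MetricStructure L M} (x y : ℕ → M) :
    Tendsto (fun n => dist (x n) (y n)) (hyperfilter ℕ) (𝓝 (dist (mk S x) (mk S y))) :=
  UltraSeq.tendsto_dist (S := S) x y

/-- `G` is the limit of `F` along the ultrafilter: its value at the classes of some sequences is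
the limit of the values of `F` along these sequences. -/
def IsUltralimit (S : MetricStructure L M) {α : Type} (F : (α → M) → ℝ)
    (G : (α → S.Ultrapower) → ℝ) : Prop :=
  ∀ x : α → ℕ → M, Tendsto (fun n => F fun i => x i n) (hyperfilter ℕ)
    (𝓝 (G fun i => Ultrapower.mk S (x i)))

variable {S : MetricStructure L M}

/-- A uniformly continuous bounded function of finitely many variables has a uniformly continuous
ultralimit. -/
theorem exists_isUltralimit {k : ℕ} {F : (Fin k → M) → ℝ} (hF : UniformContinuous F)
    (hb : ∃ K : ℝ, ∀ x, |F x| ≤ K) :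
    ∃ G : (Fin k → S.Ultrapower) → ℝ, S.IsUltralimit F G ∧ UniformContinuous G := by
  have hlim : ∀ x : Fin k → ℕ → M,
      ∃ l, Tendsto (fun n => F fun i => x i n) (hyperfilter ℕ) (𝓝 l) :=
    fun x => exists_tendsto_of_bounded _ (hb.imp fun K hK n => hK _)
  have key : ∀ ε > 0, ∃ δ > 0, ∀ (x y : Fin k → ℕ → M) (l l' : ℝ),
      Tendsto (fun n => F fun i => x i n) (hyperfilter ℕ) (𝓝 l) →
      Tendsto (fun n => F fun i => y i n) (hyperfilter ℕ) (𝓝 l') →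
      (∀ i, dist (Ultrapower.mk S (x i)) (Ultrapower.mk S (y i)) < δ) → dist l l' ≤ ε := by
    intro ε hε
    obtain ⟨δ, hδ, h⟩ := Metric.uniformContinuous_iff.1 hF ε hε
    refine ⟨δ, hδ, fun x y l l' hl hl' hxy => le_of_tendsto (hl.dist hl') ?_⟩
    filter_upwards [eventually_all.2 fun i =>
      (Ultrapower.tendsto_dist (S := S) (x i) (y i)).eventually (gt_mem_nhds (hxy i))] with n hn
    exact (h ((dist_pi_lt_iff hδ).2 hn)).le
  choose rep hrep using fun X : Fin k → S.Ultrapower => Ultrapower.exists_mk X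
  choose l hl using hlim
  refine ⟨fun X => l (rep X), fun x => ?_, Metric.uniformContinuous_iff.2 fun ε hε => ?_⟩
  · have e : l x = l (rep fun i => Ultrapower.mk S (x i)) := by
      refine eq_of_forall_dist_le fun ε hε => ?_
      obtain ⟨δ, hδ, h⟩ := key ε hε
      refine h _ _ _ _ (hl _) (hl _) fun i => ?_
      rw [← congrFun (hrep fun i => Ultrapower.mk S (x i)) i, dist_self]
      exact hδ
    have hx := hl x
    rwa [e] at hx
  · obtain ⟨δ, hδ, h⟩ := key (ε / 2) (half_pos hε)
    refine ⟨δ, hδ, fun {X Y} hXY => (h _ _ _ _ (hl _) (hl _) fun i => ?_).trans_lt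
      (half_lt_self hε)⟩
    rw [← congrFun (hrep X) i, ← congrFun (hrep Y) i]
    exact (dist_pi_lt_iff hδ).1 hXY i

theorem Ultrapower.pred_exists (S : MetricStructure L M) (i : L.Idx) :
    ∃ G : (Fin (L.arity i) → S.Ultrapower) → ℝ, S.IsUltralimit (S.pred i) G ∧
      UniformContinuous G :=
  exists_isUltralimit (S.pred_unifCont i) (S.pred_bounded i)

theorem IsUltralimit.bounded {α : Type} {F : (α → M) → ℝ} {G : (α → S.Ultrapower) → ℝ}
    (h : S.IsUltralimit F G) {K : ℝ} (hK : ∀ x, |F x| ≤ K) (X : α → S.Ultrapower) :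
    |G X| ≤ K := by
  obtain ⟨x, rfl⟩ := Ultrapower.exists_mk X
  exact le_of_tendsto (h x).abs (Eventually.of_forall fun n => hK _)

/-- The ultrapower of a metric structure along `hyperfilter ℕ`. -/
noncomputable def ultrapower (S : MetricStructure L M) : MetricStructure L S.Ultrapower where
  nonempty := ⟨Ultrapower.mk S fun _ => S.nonempty.some⟩
  complete := inferInstance
  bounded := by
    obtain ⟨D, hD⟩ := S.bounded
    refine ⟨D, fun X Y => ?_⟩
    obtain ⟨x, hx⟩ := Ultrapower.exists_mk fun _ : Unit => X
    obtain ⟨y, hy⟩ := Ultrapower.exists_mk fun _ : Unit => Y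
    rw [show X = _ from congrFun hx (), show Y = _ from congrFun hy ()]
    exact le_of_tendsto (Ultrapower.tendsto_dist _ _) (Eventually.of_forall fun n => hD _ _)
  pred i := (Ultrapower.pred_exists S i).choose
  pred_unifCont i := (Ultrapower.pred_exists S i).choose_spec.2
  pred_bounded i := by
    obtain ⟨K, hK⟩ := S.pred_bounded i
    exact ⟨K, (Ultrapower.pred_exists S i).choose_spec.1.bounded hK⟩

theorem ultrapower_pred (i : L.Idx) : S.IsUltralimit (S.pred i) (S.ultrapower.pred i) :=
  (Ultrapower.pred_exists S i).choose_spec.1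

theorem mk_optionElim {α : Type} (x : α → ℕ → M) (y : ℕ → M) :
    (fun o : Option α => o.elim (Ultrapower.mk S y) fun i => Ultrapower.mk S (x i)) =
      fun o => Ultrapower.mk S (o.elim y x) := by
  ext (_ | i) <;> rfl

/-- Suprema over one variable commute with ultralimits: an approximate maximum is found
coordinatewise. -/
theorem IsUltralimit.sup {α : Type} {F : (Option α → M) → ℝ} {G : (Option α → S.Ultrapower) → ℝ}
    (h : S.IsUltralimit F G) (hb : ∃ K : ℝ, ∀ x, |F x| ≤ K) :
    S.IsUltralimit (fun x => ⨆ m, F fun o => o.elim m x) (fun X => ⨆ m, G fun o => o.elim m X) := by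
  have := S.nonempty
  have := S.ultrapower.nonempty
  obtain ⟨K, hK⟩ := hb
  have hF : ∀ x, BddAbove (Set.range fun m => F fun o : Option α => o.elim m x) := fun x =>
    ⟨K, by rintro _ ⟨i, rfl⟩; exact (abs_le.1 (hK _)).2⟩
  have hG : ∀ X, BddAbove (Set.range fun m => G fun o : Option α => o.elim m X) := fun X =>
    ⟨K, by rintro _ ⟨i, rfl⟩; exact (abs_le.1 (h.bounded hK _)).2⟩
  intro x
  obtain ⟨l, hl⟩ := exists_tendsto_of_bounded (hyperfilter ℕ)
    (g := fun n => ⨆ m, F fun o => o.elim m fun i => x i n) ⟨K, fun n => abs_le.2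
      ⟨le_ciSup_of_le (hF _) (Classical.arbitrary M) (abs_le.1 (hK _)).1,
        ciSup_le fun m => (abs_le.1 (hK _)).2⟩⟩
  convert hl using 2
  refine le_antisymm (ciSup_le fun Y => ?_) (le_of_forall_pos_le_add fun ε hε => ?_)
  · obtain ⟨y, hy⟩ := Ultrapower.exists_mk fun _ : Unit => Y
    rw [show Y = _ from congrFun hy (), mk_optionElim]
    refine le_of_tendsto_of_tendsto' (h _) hl fun n => ?_
    rw [optionElim_apply]
    exact le_ciSup (hF _) (y () n)
  · choose y hy using fun n => exists_lt_of_lt_ciSup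
      (sub_lt_self (⨆ m, F fun o => o.elim m fun i => x i n) hε)
    refine le_trans ?_ (add_le_add_left (le_ciSup (hG _) (Ultrapower.mk S y)) ε)
    rw [mk_optionElim]
    refine le_of_tendsto_of_tendsto' hl ((h _).add_const ε) fun n => ?_
    rw [optionElim_apply]
    linarith [hy n]

theorem IsUltralimit.neg {α : Type} {F : (α → M) → ℝ} {G : (α → S.Ultrapower) → ℝ}
    (h : S.IsUltralimit F G) : S.IsUltralimit (fun x => -F x) (fun X => -G X) :=
  fun x => (h x).neg

theorem IsUltralimit.inf {α : Type} {F : (Option α → M) → ℝ} {G : (Option α → S.Ultrapower) → ℝ}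
    (h : S.IsUltralimit F G) (hb : ∃ K : ℝ, ∀ x, |F x| ≤ K) :
    S.IsUltralimit (fun x => ⨅ m, F fun o => o.elim m x) (fun X => ⨅ m, G fun o => o.elim m X) := by
  have h' := (h.neg.sup (by simpa using hb)).neg
  simpa only [← real_iInf_eq_neg_iSup_neg] using h'

/-- Łoś's theorem: every definable predicate of the ultrapower is the ultralimit of a definable
predicate of the structure. -/
theorem IsDefinable.exists_isUltralimit {α : Type} {G : (α → S.Ultrapower) → ℝ}
    (hG : S.ultrapower.IsDefinable G) : ∃ F, S.IsDefinable F ∧ S.IsUltralimit F G := by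
  induction hG with
  | basic i => exact ⟨_, .basic i, ultrapower_pred i⟩
  | metric => exact ⟨_, .metric, fun x => Ultrapower.tendsto_dist (x 0) (x 1)⟩
  | comb u hu G hG ih =>
    choose F hF hFG using ih
    exact ⟨_, .comb u hu F hF, fun x =>
      (hu.tendsto _).comp (tendsto_pi_nhds.2 fun j => hFG j x)⟩
  | rename σ hG ih =>
    obtain ⟨F, hF, hFG⟩ := ih
    exact ⟨_, hF.rename σ, fun x => hFG (x ∘ σ)⟩
  | sup hG ih =>
    obtain ⟨F, hF, hFG⟩ := ih
    exact ⟨_, hF.sup, hFG.sup hF.bounded⟩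
  | inf hG ih =>
    obtain ⟨F, hF, hFG⟩ := ih
    exact ⟨_, hF.inf, hFG.inf hF.bounded⟩
  | lim G g hG h ih =>
    choose F hF hFG using ih
    -- On constant sequences, the approximants agree with those of the ultrapower.
    have hc : ∀ n x, F n x = G n fun i => Ultrapower.mk S fun _ => x i := fun n x =>
      tendsto_nhds_unique tendsto_const_nhds (hFG n fun i _ => x i)
    have hlim : TendstoUniformly F (fun x => g fun i => Ultrapower.mk S fun _ => x i) atTop := by
      rw [show F = fun n x => G n fun i => Ultrapower.mk S fun _ => x i from
        funext fun n => funext fun x => hc n x]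
      exact h.comp fun x : _ → M => fun i => Ultrapower.mk S fun _ => x i
    refine ⟨_, .lim F _ hF hlim, fun x => ?_⟩
    refine Metric.tendsto_nhds.2 fun ε hε => ?_
    obtain ⟨n, h1, h2⟩ := ((Metric.tendstoUniformly_iff.1 h (ε / 3) (by positivity)).and
      (Metric.tendstoUniformly_iff.1 hlim (ε / 3) (by positivity))).exists
    filter_upwards [Metric.tendsto_nhds.1 (hFG n x) (ε / 3) (by positivity)] with k hk
    have h3 := h1 fun i => Ultrapower.mk S (x i)
    have h4 := h2 fun i => x i k
    rw [Real.dist_eq, abs_lt] at *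
    constructor <;> linarith [h3.1, h3.2, h4.1, h4.2, hk.1, hk.2]

theorem IsUltralimit.const {α : Type} {F : (α → M) → ℝ} {G : (α → S.Ultrapower) → ℝ}
    (h : S.IsUltralimit F G) (x : α → M) : G (fun i => Ultrapower.mk S fun _ => x i) = F x :=
  (tendsto_nhds_unique tendsto_const_nhds (h fun i _ => x i)).symm

/-- The ultrapower as an elementary extension, through the diagonal embedding. -/
noncomputable def ultrapowerExtension (S : MetricStructure L M) : S.ElementaryExtension where
  carrier := S.Ultrapower
  str := S.ultrapower
  emb m := Ultrapower.mk S fun _ => m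
  isometry := Isometry.of_dist_eq fun x y =>
    tendsto_nhds_unique (Ultrapower.tendsto_dist _ _) tendsto_const_nhds
  pred_emb i x := (ultrapower_pred i).const x
  elementary β _ p := by
    intro ε hε T hT
    obtain ⟨b, -, hb⟩ := approxFinRealized_univ p ε hε T hT
    obtain ⟨b, rfl⟩ := Ultrapower.exists_mk b
    have hev : ∀ h ∈ T, ∀ᶠ n in (hyperfilter ℕ : Filter ℕ),
        |(h : (β → S.Ultrapower) → ℝ) fun i => Ultrapower.mk S fun _ => b i n| < ε := by
      rintro ⟨h, γ, G, c, hc, hG⟩ hh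
      obtain ⟨c', hc'⟩ := Classical.skolem.1 hc
      obtain rfl : (fun i => Ultrapower.mk S fun _ => c' i) = c := funext hc'
      obtain ⟨F, hF, hFG⟩ := G.definable.exists_isUltralimit
      -- By Łoś, `h` is small at almost all coordinates of `b`, as it is small at the class of `b`.
      have hlt : |h fun i => Ultrapower.mk S (b i)| < ε := hb _ hh
      rw [hG] at hlt
      have hlim := (hFG (Sum.elim (fun i _ => c' i) b)).abs
      rw [show (fun i => Ultrapower.mk S (Sum.elim (fun i _ => c' i) b i)) =
        Sum.elim (fun i => Ultrapower.mk S fun _ => c' i) fun i => Ultrapower.mk S (b i) by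
          ext (i | i) <;> rfl] at hlim
      filter_upwards [hlim.eventually (gt_mem_nhds hlt)] with n hn
      change |h fun i => Ultrapower.mk S fun _ => b i n| < ε
      rw [hG]
      rw [← hFG.const] at hn
      rwa [show (fun i => Ultrapower.mk S fun _ => Sum.elim (fun i _ => c' i) b i n) =
        Sum.elim (fun i => Ultrapower.mk S fun _ => c' i) fun i => Ultrapower.mk S fun _ => b i n by
          ext (i | i) <;> rfl] at hn
    obtain ⟨n, hn⟩ := ((eventually_all_finset T).2 hev).exists
    exact ⟨_, fun j => ⟨b j n, rfl⟩, hn⟩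

/-- The extension of a definable predicate to the ultrapower is its ultralimit. -/
theorem isUltralimit_extend {α : Type} (f : S.DefPred α) :
    S.IsUltralimit f (S.ultrapowerExtension.extend f) := by
  obtain ⟨F, hF, hFG⟩ :=
    IsDefinable.exists_isUltralimit (S.ultrapowerExtension.extend f).definable
  have e : F = f := funext fun x => (hFG.const x).symm.trans (S.ultrapowerExtension.extend_emb f x)
  exact e ▸ hFG

end MetricStructure

/-! ### Iterated ultrafilters -/

section iterated

variable (U : Ultrafilter ℕ)

/-- The `n`-fold product of an ultrafilter `U` on `ℕ` with itself, as an ultrafilter on the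
sequences of natural numbers: the coordinates `0, …, n - 1` are chosen successively, each of them
`U`-generic over the previous ones, and the other coordinates are `0`. -/
noncomputable def iterUltrafilter : ℕ → Ultrafilter (ℕ → ℕ)
  | 0 => pure 0
  | n + 1 => (iterUltrafilter n).bind fun t => U.map fun i => Function.update t n i

theorem eventually_iterUltrafilter_succ {n : ℕ} {P : (ℕ → ℕ) → Prop} :
    (∀ᶠ t in (iterUltrafilter U (n + 1) : Filter (ℕ → ℕ)), P t) ↔
      ∀ᶠ t in (iterUltrafilter U n : Filter (ℕ → ℕ)), ∀ᶠ i in (U : Filter ℕ),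
        P (Function.update t n i) := Iff.rfl

/-- Indiscernibility of the coordinates of the iterated ultrafilter: every increasing `k`-tuple of
coordinates has the same distribution. -/
theorem eventually_iterUltrafilter_comp {n : ℕ} : ∀ {k : ℕ} {j : Fin k → ℕ}, StrictMono j →
    (∀ i, j i < n) → ∀ P : (Fin k → ℕ) → Prop,
    ((∀ᶠ t in (iterUltrafilter U n : Filter (ℕ → ℕ)), P fun i => t (j i)) ↔
      ∀ᶠ t in (iterUltrafilter U k : Filter (ℕ → ℕ)), P fun i => t i) := by
  induction n with
  | zero =>
    intro k j hj hn P
    cases k with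
    | zero =>
      have : j = fun i : Fin 0 => (i : ℕ) := Subsingleton.elim _ _
      rw [this]
    | succ k => exact absurd (hn 0) (Nat.not_lt_zero _)
  | succ n ih =>
    intro k j hj hn P
    by_cases hlast : ∀ i, j i < n
    · rw [← ih hj hlast, eventually_iterUltrafilter_succ]
      simp only [Function.update_of_ne (hlast _).ne, eventually_const]
    · push Not at hlast
      obtain ⟨i₀, hi₀⟩ := hlast
      cases k with
      | zero => exact i₀.elim0
      | succ k =>
        have hl : j (Fin.last k) = n := le_antisymm (Nat.lt_succ_iff.1 (hn _))
          (hi₀.trans (hj.monotone (Fin.le_last _)))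
        have hc : ∀ i : Fin k, j i.castSucc < n := fun i => hl ▸ hj (Fin.castSucc_lt_last i)
        rw [eventually_iterUltrafilter_succ, eventually_iterUltrafilter_succ]
        have e1 : ∀ (t : ℕ → ℕ) (i : ℕ), (fun z => Function.update t n i (j z)) =
            Fin.snoc (α := fun _ => ℕ) (fun z : Fin k => t (j z.castSucc)) i := fun t i => by
          ext z
          refine Fin.lastCases ?_ (fun z => ?_) z
          · simp [hl]
          · simp [(hc z).ne]
        have e2 : ∀ (t : ℕ → ℕ) (i : ℕ), (fun z : Fin (k + 1) => Function.update t k i z) =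
            Fin.snoc (α := fun _ => ℕ) (fun z : Fin k => t z) i := fun t i => by
          ext z
          refine Fin.lastCases ?_ (fun z => ?_) z
          · simp
          · simp [z.2.ne]
        simp only [e1, e2]
        exact ih (fun a b hab => hj (Fin.castSucc_lt_castSucc_iff.2 hab)) hc
          fun s => ∀ᶠ i in (U : Filter ℕ), P (Fin.snoc s i)

/-- The property `Q` holds once the coordinates `k, …, k + r - 1` of `t` are replaced by successive
`U`-generic ones. -/
def GenericallyFrom (Q : (ℕ → ℕ) → Prop) : ℕ → ℕ → (ℕ → ℕ) → Prop
  | 0, _, t => Q t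
  | r + 1, k, t => ∀ᶠ i in (U : Filter ℕ), GenericallyFrom Q r (k + 1) (Function.update t k i)

theorem eventually_genericallyFrom {Q : (ℕ → ℕ) → Prop} : ∀ {r k : ℕ},
    (∀ᶠ t in (iterUltrafilter U k : Filter (ℕ → ℕ)), GenericallyFrom U Q r k t) ↔
      ∀ᶠ t in (iterUltrafilter U (k + r) : Filter (ℕ → ℕ)), Q t
  | 0, _ => Iff.rfl
  | r + 1, k => by
    rw [show k + (r + 1) = k + 1 + r by ring, ← eventually_genericallyFrom (r := r)]
    exact Iff.rfl

/-- A sequence may be chosen recursively so that each of its terms satisfies a condition on the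
previous ones. -/
theorem exists_seq_forall_rel {X : Type*} [Inhabited X] {C : ℕ → (ℕ → X) → X → Prop}
    (h : ∀ J ψ, ∃ x, C J ψ x) :
    ∃ φ : ℕ → X, ∀ J, ∃ ψ : ℕ → X, (∀ i < J, ψ i = φ i) ∧ C J ψ (φ J) := by
  choose g hg using h
  let Ψ : ℕ → ℕ → X := fun J =>
    Nat.rec (fun _ => default) (fun J ψ => Function.update ψ J (g J ψ)) J
  refine ⟨fun J => g J (Ψ J), fun J => ⟨Ψ J, ?_, hg _ _⟩⟩
  induction J with
  | zero => exact fun i hi => absurd hi (Nat.not_lt_zero i)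
  | succ J ih =>
    intro i hi
    change Function.update (Ψ J) J (g J (Ψ J)) i = _
    rcases (Nat.lt_succ_iff.1 hi).lt_or_eq with hlt | rfl
    · rw [Function.update_of_ne hlt.ne, ih i hlt]
    · rw [Function.update_self]

/-- Generic subsequences: if countably many properties `Q m` of `n m`-tuples hold generically for a
nonprincipal ultrafilter, then there is a sequence all of whose increasing `n m`-tuples, up to
finitely many terms depending on `m`, satisfy `Q m`. -/
theorem exists_generic_subsequence {U : Ultrafilter ℕ} (hU : (U : Filter ℕ) ≤ atTop) (n : ℕ → ℕ)
    (Q : ℕ → (ℕ → ℕ) → Prop)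
    (h : ∀ m, ∀ᶠ t in (iterUltrafilter U (n m) : Filter (ℕ → ℕ)), Q m t) :
    ∃ φ : ℕ → ℕ, StrictMono φ ∧ ∀ m (j : ℕ → ℕ), StrictMono j → m ≤ j 0 →
      Q m fun i => if i < n m then φ (j i) else 0 := by
  -- The term `J` preserves the genericity of all tuples formed from the previous terms.
  have hC : ∀ (J : ℕ) (ψ : ℕ → ℕ), ∃ x, (∀ i : Fin J, ψ i < x) ∧
      ∀ (m : Fin (J + 1)) (k : Fin (J + 1)) (s : Fin k → Fin J), ∀ r : Fin (n m + 1),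
        GenericallyFrom U (Q m) (r + 1) k (fun i => if hi : i < k then ψ (s ⟨i, hi⟩) else 0) →
        GenericallyFrom U (Q m) r (k + 1)
          (Function.update (fun i => if hi : i < k then ψ (s ⟨i, hi⟩) else 0) k x) := by
    intro J ψ
    have h1 : ∀ᶠ x in (U : Filter ℕ), ∀ i : Fin J, ψ i < x :=
      eventually_all.2 fun i => hU (eventually_gt_atTop _)
    refine (h1.and ?_).exists
    refine eventually_all.2 fun m => eventually_all.2 fun k => eventually_all.2 fun s =>
      eventually_all.2 fun r => ?_
    by_cases hg : GenericallyFrom U (Q m) (r + 1) k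
      (fun i => if hi : i < k then ψ (s ⟨i, hi⟩) else 0)
    · exact Eventually.mono hg fun x hx _ => hx
    · exact Eventually.of_forall fun x hx => absurd hx hg
  obtain ⟨φ, hφ⟩ := exists_seq_forall_rel hC
  refine ⟨φ, strictMono_nat_of_lt_succ fun J => ?_, fun m j hj hm => ?_⟩
  · obtain ⟨ψ, hψ, hlt, -⟩ := hφ (J + 1)
    rw [← hψ J (Nat.lt_succ_self J)]
    exact hlt ⟨J, Nat.lt_succ_self J⟩
  · have key : ∀ k ≤ n m, GenericallyFrom U (Q m) (n m - k) k
        fun i => if i < k then φ (j i) else 0 := by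
      intro k
      induction k with
      | zero =>
        intro _
        have h0 := (eventually_genericallyFrom U (Q := Q m) (r := n m) (k := 0)).2
          (by rw [zero_add]; exact h m)
        exact h0
      | succ k ih =>
        intro hk
        obtain ⟨ψ, hψ, -, hstep⟩ := hφ (j k)
        have hjk : k ≤ j k := hj.le_apply
        have h2 := hstep ⟨m, Nat.lt_succ_of_le (hm.trans (hj.monotone (Nat.zero_le k)))⟩
          ⟨k, Nat.lt_succ_of_le hjk⟩ (fun i => ⟨j i, hj i.2⟩)
          ⟨n m - (k + 1), by simp only; omega⟩
        have e : (fun i => if hi : i < k then ψ (j i) else 0) =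
            fun i => if i < k then φ (j i) else 0 := by
          ext i
          split_ifs with hi
          · exact hψ _ (hj hi)
          · rfl
        have e' : Function.update (fun i => if i < k then φ (j i) else 0) k (φ (j k)) =
            fun i => if i < k + 1 then φ (j i) else 0 := by
          ext i
          rcases lt_trichotomy i k with hi | rfl | hi
          · simp [Function.update_of_ne hi.ne, hi, hi.trans (Nat.lt_succ_self k)]
          · simp
          · simp [Function.update_of_ne hi.ne', hi.not_gt, Nat.not_lt.2 (Nat.succ_le_of_lt hi)]
        have h3 := ih (Nat.le_of_succ_le hk)
        rw [show n m - k = n m - (k + 1) + 1 by omega] at h3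
        simp only [dite_eq_ite] at h2 e
        rw [e, e'] at h2
        exact h2 h3
    have := key (n m) le_rfl
    rw [Nat.sub_self] at this
    exact this

/-- The limit of the iterated ultrafilters: all the coordinates are chosen successively. -/
noncomputable def omegaUltrafilter : Ultrafilter (ℕ → ℕ) :=
  (hyperfilter ℕ).bind (iterUltrafilter U)

theorem eventually_omegaUltrafilter_comp {k : ℕ} {j : Fin k → ℕ} (hj : StrictMono j)
    (P : (Fin k → ℕ) → Prop) :
    (∀ᶠ t in (omegaUltrafilter U : Filter (ℕ → ℕ)), P fun i => t (j i)) ↔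
      ∀ᶠ t in (iterUltrafilter U k : Filter (ℕ → ℕ)), P fun i => t i := by
  have h : (∀ᶠ t in (omegaUltrafilter U : Filter (ℕ → ℕ)), P fun i => t (j i)) ↔
    ∀ᶠ n in (hyperfilter ℕ : Filter ℕ), ∀ᶠ t in (iterUltrafilter U n : Filter (ℕ → ℕ)),
      P fun i => t (j i) := Iff.rfl
  obtain ⟨N, hN⟩ : ∃ N, ∀ i, j i < N :=
    ⟨∑ i, (j i + 1), fun i => Nat.lt_of_succ_le
      (Finset.single_le_sum (f := fun i => j i + 1) (fun _ _ => Nat.zero_le _) (Finset.mem_univ i))⟩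
  rw [h, ← eventually_const (f := (hyperfilter ℕ : Filter ℕ)) (p := ∀ᶠ t in
    (iterUltrafilter U k : Filter (ℕ → ℕ)), P fun i => t i)]
  refine eventually_congr ?_
  filter_upwards [eventually_hyperfilter_ge N] with n hn
  exact eventually_iterUltrafilter_comp U hj (fun i => (hN i).trans_le hn) P

end iterated

namespace MetricStructure

universe u v

variable {L : Signature.{v}} {M : Type u} [MetricSpace M] {S : MetricStructure L M}

/-! ### Asymptotic value sequences -/

section asymptotic

variable {α β : Type} [Encodable β]

/-- `w` is, up to arbitrarily small errors on finite pieces, the sequence of the values `f(a_i, m)`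
for some `m` in `B`. Membership in `B` is required only up to a small error, too. -/
def IsAsymptoticValue (f : S.DefPred (α ⊕ β)) (B : Set (β → M)) (a : ℕ → α → M) (w : ℕ → ℝ) :
    Prop :=
  ∀ n : ℕ, ∀ ε > 0, ∃ m : β → M, distTo B m < ε ∧ ∀ i < n, |f (Sum.elim (a i) m) - w i| < ε

variable {f : S.DefPred (α ⊕ β)} {B : Set (β → M)} {a : ℕ → α → M} {w : ℕ → ℝ}

theorem isAsymptoticValue_of_tendsto {J : Type*} {Φ : Filter J} [Φ.NeBot] {m : J → β → M}
    (h0 : Tendsto (fun j => distTo B (m j)) Φ (𝓝 0))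
    (h : ∀ i, Tendsto (fun j => f (Sum.elim (a i) (m j))) Φ (𝓝 (w i))) :
    IsAsymptoticValue f B a w := by
  intro n ε hε
  obtain ⟨j, h1, h2⟩ := ((h0.eventually (gt_mem_nhds hε)).and ((eventually_all_finset
    (Finset.range n)).2 fun i _ => Metric.tendsto_nhds.1 (h i) ε hε)).exists
  exact ⟨m j, h1, fun i hi => h2 i (Finset.mem_range.2 hi)⟩

theorem IsAsymptoticValue.exists_tendsto (h : IsAsymptoticValue f B a w) :
    ∃ m : ℕ → β → M, Tendsto (fun n => distTo B (m n)) (hyperfilter ℕ) (𝓝 0) ∧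
      ∀ i, Tendsto (fun n => f (Sum.elim (a i) (m n))) (hyperfilter ℕ) (𝓝 (w i)) := by
  choose m hm hmw using fun n : ℕ => h n (1 / (n + 1)) Nat.one_div_pos_of_nat
  have hlim : Tendsto (fun n : ℕ => 1 / ((n : ℝ) + 1)) (hyperfilter ℕ) (𝓝 0) :=
    tendsto_one_div_add_atTop_nhds_zero_nat.mono_left Nat.hyperfilter_le_atTop
  refine ⟨m, squeeze_zero (fun n => distTo_nonneg _ _) (fun n => (hm n).le) hlim, fun i => ?_⟩
  refine tendsto_iff_dist_tendsto_zero.2 (squeeze_zero' (Eventually.of_forall fun n => dist_nonneg)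
    ?_ hlim)
  filter_upwards [eventually_hyperfilter_ge (i + 1)] with n hn
  exact (hmw n i hn).le

theorem IsAsymptoticValue.abs_apply_le (h : IsAsymptoticValue f B a w) {K : ℝ} (hK : ∀ x, |f x| ≤ K)
    (i : ℕ) : |w i| ≤ K := by
  obtain ⟨m, -, hm⟩ := h.exists_tendsto
  exact le_of_tendsto (hm i).abs (Eventually.of_forall fun n => hK _)

/-- The values at a type in `B*` form an asymptotic value sequence. -/
theorem IsDefinableSet.isAsymptoticValue_value (hB : S.IsDefinableSet B)
    {p : S.TypeSpace Set.univ β} (hp : p ∈ hB.typeSet) (f : S.DefPred (α ⊕ β)) (a : ℕ → α → M) :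
    IsAsymptoticValue f B a fun i => value p (f.slice (a i)) := by
  classical
  intro n ε hε
  obtain ⟨m, -, hm⟩ := approxFinRealized_univ p ε hε (insert (hB.distPred.over Set.univ)
    ((Finset.range n).image fun i =>
      f.slice (a i) - algebraMap ℝ _ (value p (f.slice (a i))))) (by
    intro h hh
    rcases Finset.mem_insert.1 hh with rfl | hh
    · exact hp
    · obtain ⟨i, -, rfl⟩ := Finset.mem_image.1 hh
      exact value_spec _ _)
  refine ⟨m, (le_abs_self _).trans_lt (hm _ (Finset.mem_insert_self _ _)), fun i hi => ?_⟩
  exact hm _ (Finset.mem_insert_of_mem (Finset.mem_image_of_mem _ (Finset.mem_range.2 hi)))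

/-- Every asymptotic value sequence is the sequence of the values at some type in `B*`. -/
theorem IsAsymptoticValue.exists_type (h : IsAsymptoticValue f B a w) (hB : S.IsDefinableSet B) :
    ∃ p ∈ hB.typeSet, ∀ i, value p (f.slice (a i)) = w i := by
  obtain ⟨m, h0, hm⟩ := h.exists_tendsto
  obtain ⟨p, hp⟩ := exists_limit_type (S := S) Set.univ (hyperfilter ℕ) m
  exact ⟨p, (mem_iff_value_eq_zero _ _).2 (tendsto_nhds_unique (hp _) h0),
    fun i => tendsto_nhds_unique (hp _) (hm i)⟩

/-- The values at a zero of `P_B` in an elementary extension form an asymptotic value sequence. -/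
theorem ElementaryExtension.isAsymptoticValue_extend (E : S.ElementaryExtension)
    (hB : S.IsDefinableSet B) {b : β → E.carrier} (hb : E.extend hB.distPred b = 0)
    (f : S.DefPred (α ⊕ β)) (a : ℕ → α → M) :
    IsAsymptoticValue f B a fun i => E.extend f (Sum.elim (E.emb ∘ a i) b) := by
  classical
  intro n ε hε
  let g : ℕ → E.str.defAlgebra (Set.range E.emb) β := fun i =>
    ⟨fun y => E.extend f (Sum.elim (E.emb ∘ a i) y), α, E.extend f, E.emb ∘ a i,
      fun z => ⟨a i z, rfl⟩, fun _ => rfl⟩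
  obtain ⟨c, hc, hcT⟩ := E.elementary β (E.str.tp _ b) ε hε
    (insert ((E.extend hB.distPred).over _) ((Finset.range n).image fun i =>
      g i - algebraMap ℝ _ (E.extend f (Sum.elim (E.emb ∘ a i) b)))) (by
    intro h hh
    rw [mem_tp_iff]
    rcases Finset.mem_insert.1 hh with rfl | hh
    · exact hb
    · obtain ⟨i, -, rfl⟩ := Finset.mem_image.1 hh
      exact sub_self _)
  choose m hm using hc
  obtain rfl : E.emb ∘ m = c := funext hm
  refine ⟨m, ?_, fun i hi => ?_⟩
  · have h1 := hcT _ (Finset.mem_insert_self _ _)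
    change |E.extend hB.distPred (E.emb ∘ m)| < ε at h1
    rw [E.extend_emb] at h1
    exact (le_abs_self _).trans_lt h1
  · have h1 := hcT _ (Finset.mem_insert_of_mem (Finset.mem_image_of_mem _ (Finset.mem_range.2 hi)))
    change |E.extend f (Sum.elim (E.emb ∘ a i) (E.emb ∘ m)) - _| < ε at h1
    rw [← Sum.comp_elim, E.extend_emb] at h1
    exact h1

/-- Every asymptotic value sequence is realized by a zero of `P_B` in the ultrapower. -/
theorem IsAsymptoticValue.exists_ultrapower (h : IsAsymptoticValue f B a w)
    (hB : S.IsDefinableSet B) :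
    ∃ b : β → S.ultrapowerExtension.carrier, S.ultrapowerExtension.extend hB.distPred b = 0 ∧
      ∀ i, S.ultrapowerExtension.extend f (Sum.elim (S.ultrapowerExtension.emb ∘ a i) b) = w i := by
  obtain ⟨m, h0, hm⟩ := h.exists_tendsto
  refine ⟨fun z => Ultrapower.mk S fun n => m n z,
    tendsto_nhds_unique (isUltralimit_extend hB.distPred fun z n => m n z) h0, fun i => ?_⟩
  have h1 := isUltralimit_extend f (Sum.elim (fun z _ => a i z) fun z n => m n z)
  have e1 : (fun z => Ultrapower.mk S (Sum.elim (fun z _ => a i z) (fun z n => m n z) z)) =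
      Sum.elim (S.ultrapowerExtension.emb ∘ a i) fun z => Ultrapower.mk S fun n => m n z := by
    ext (z | z) <;> rfl
  have e2 : ∀ n, (fun z => Sum.elim (fun z (_ : ℕ) => a i z) (fun z n => m n z) z n) =
      Sum.elim (a i) (m n) := fun n => by ext (z | z) <;> rfl
  rw [e1] at h1
  simp only [e2] at h1
  exact tendsto_nhds_unique h1 (hm i)

/-- In a `∅`-saturated structure, an asymptotic value sequence is realized inside the structure,
after replacing `(a_i)` by another sequence of the same type. -/
theorem IsAsymptoticValue.exists_realization [Countable α] (hS : S.IsEmptySaturated)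
    (h : IsAsymptoticValue f B a w) (hB : S.IsDefinableSet B) :
    ∃ (a' : ℕ → α → M) (b : β → M), b ∈ B ∧ (∀ i, f (Sum.elim (a' i) b) = w i) ∧
      ∀ g : S.DefPred (ℕ × α), g (fun z => a' z.1 z.2) = g (fun z => a z.1 z.2) := by
  obtain ⟨m, h0, hm⟩ := h.exists_tendsto
  obtain ⟨c, hc⟩ := hS.exists_limit (hyperfilter ℕ)
    fun n => Sum.elim (fun z : ℕ × α => a z.1 z.2) (m n)
  refine ⟨fun i z => c (Sum.inl (i, z)), fun z => c (Sum.inr z), ?_, fun i => ?_, fun g => ?_⟩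
  · exact (hB.distTo_eq_zero_iff _).1 (tendsto_nhds_unique
      (hc ⟨_, hB.definable.rename (γ := (ℕ × α) ⊕ β) Sum.inr⟩) h0)
  · have h1 := hc ⟨_, f.definable.rename (γ := (ℕ × α) ⊕ β) (Sum.map (fun z => (i, z)) id)⟩
    refine tendsto_nhds_unique ?_ (hm i)
    convert h1 using 3 with n
    · ext (z | z) <;> rfl
    · ext (z | z) <;> rfl
  · exact tendsto_nhds_unique
      (hc ⟨_, g.definable.rename (γ := (ℕ × α) ⊕ β) Sum.inl⟩) tendsto_const_nhds

/-- The independence property, expressed through asymptotic value sequences: the members of the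
independent family are realized simultaneously in the ultrapower. -/
theorem lacksIP_iff [Encodable α] (f : S.DefPred (α ⊕ β)) (A : Set (α → M))
    (hB : S.IsDefinableSet B) :
    LacksIP f A hB ↔ ¬ ∃ r s : ℝ, r ≠ s ∧ ∃ a : ℕ → α → M, (∀ i, a i ∈ A) ∧
      ∀ w : ℕ → ℝ, (∀ i, w i = r ∨ w i = s) → IsAsymptoticValue f B a w := by
  classical
  refine not_congr ⟨?_, ?_⟩
  · rintro ⟨r, s, hrs, a, ha, E, b, hb, hf⟩
    refine ⟨r, s, hrs, a, ha, fun w hw => ?_⟩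
    convert E.isAsymptoticValue_extend hB (hb {i | w i = r}) f a using 2 with i
    by_cases h : w i = r
    · rw [(hf i {i | w i = r}).1 h, h]
    · rw [(hf i {i | w i = r}).2 h, (hw i).resolve_left h]
  · rintro ⟨r, s, hrs, a, ha, h⟩
    have h' : ∀ I : Set ℕ, IsAsymptoticValue f B a fun i => if i ∈ I then r else s := fun I =>
      h _ fun i => by by_cases hi : i ∈ I <;> simp [hi]
    choose b hb hf using fun I => (h' I).exists_ultrapower hB
    refine ⟨r, s, hrs, a, ha, S.ultrapowerExtension, b, hb, fun i I => ⟨fun hi => ?_, fun hi => ?_⟩⟩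
    · rw [hf, if_pos hi]
    · rw [hf, if_neg hi]

end asymptotic

/-! ### Patterns of values -/

section pattern

variable {α β : Type} [Encodable β]

/-- For nonnegative functions `g k`, this definable predicate measures how far `(x_k)` is from
admitting some `y` in `B` at which the pattern `g k (f(x_k, y)) = 0` holds for all `k < n`. -/
noncomputable def patternInf (f : S.DefPred (α ⊕ β)) (B : Set (β → M)) (g : ℕ → ℝ → ℝ) (n : ℕ)
    (x : Fin n × α → M) : ℝ :=
  ⨅ y : β → M, (distTo B y + ∑ k : Fin n, g k (f (Sum.elim (fun z => x (k, z)) y)))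

variable {f : S.DefPred (α ⊕ β)} {B : Set (β → M)} {g : ℕ → ℝ → ℝ}

theorem isDefinable_patternInf [Countable α] (f : S.DefPred (α ⊕ β)) (hB : S.IsDefinableSet B)
    (hg : ∀ k, Continuous (g k)) (n : ℕ) : S.IsDefinable (patternInf f B g n) := by
  have h1 := hB.definable.rename (γ := (Fin n × α) ⊕ β) Sum.inr
  have h2 := fun k : Fin n => f.definable.rename (γ := (Fin n × α) ⊕ β)
    (Sum.map (fun z => (k, z)) id)
  have h3 := IsDefinable.comb (S := S) (k := n + 1)
    (fun t => t 0 + ∑ k : Fin n, g k (t k.succ))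
    ((continuous_apply 0).add (continuous_finsetSum _ fun k _ =>
      (hg k).comp (continuous_apply k.succ)))
    (Fin.cons (fun x => distTo B (x ∘ Sum.inr))
      fun k x => f (x ∘ Sum.map (fun z => (k, z)) id)) (Fin.cases h1 h2)
  convert h3.iInf using 2 with x
  unfold patternInf
  congr 1
  ext y
  simp only [Fin.cons_zero, Fin.cons_succ]
  congr 1
  refine Finset.sum_congr rfl fun k _ => ?_
  congr 2
  ext (z | z) <;> rfl

theorem patternInf_lt_iff (hg : ∀ k t, 0 ≤ g k t) {n : ℕ} {x : Fin n × α → M} {ε : ℝ} :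
    patternInf f B g n x < ε ↔ ∃ y : β → M,
      distTo B y + ∑ k : Fin n, g k (f (Sum.elim (fun z => x (k, z)) y)) < ε := by
  have := S.nonempty
  refine ciInf_lt_iff ⟨0, ?_⟩
  rintro _ ⟨y, rfl⟩
  exact add_nonneg (distTo_nonneg _ _) (Finset.sum_nonneg fun _ _ => hg _ _)

theorem patternInf_le (hg : ∀ k t, 0 ≤ g k t) {n : ℕ} (x : Fin n × α → M) {δ : ℝ} {y : β → M}
    (h0 : distTo B y ≤ δ) (h : ∀ k : Fin n, g k (f (Sum.elim (fun z => x (k, z)) y)) ≤ δ) :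
    patternInf f B g n x ≤ (n + 1) * δ := by
  refine (ciInf_le ⟨0, ?_⟩ y).trans ?_
  · rintro _ ⟨y, rfl⟩
    exact add_nonneg (distTo_nonneg _ _) (Finset.sum_nonneg fun _ _ => hg _ _)
  · have := Finset.sum_le_card_nsmul Finset.univ _ δ fun k _ => h k
    rw [Finset.card_univ, Fintype.card_fin, nsmul_eq_mul] at this
    linarith

theorem exists_lt_of_patternInf_lt (hg : ∀ k t, 0 ≤ g k t) {n : ℕ} {x : Fin n × α → M} {ε : ℝ}
    (h : patternInf f B g n x < ε) : ∃ y : β → M, distTo B y < ε ∧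
      ∀ k : Fin n, g k (f (Sum.elim (fun z => x (k, z)) y)) < ε := by
  obtain ⟨y, hy⟩ := (patternInf_lt_iff hg).1 h
  have hs : 0 ≤ ∑ k : Fin n, g k (f (Sum.elim (fun z => x (k, z)) y)) :=
    Finset.sum_nonneg fun _ _ => hg _ _
  refine ⟨y, by linarith, fun k => ?_⟩
  have := Finset.single_le_sum (f := fun k : Fin n => g k (f (Sum.elim (fun z => x (k, z)) y)))
    (fun _ _ => hg _ _) (Finset.mem_univ k)
  have := distTo_nonneg B y
  linarith

/-- The pattern of a sequence oscillating between values at most `p` and values at least `q`. -/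
noncomputable def oscillation (p q : ℝ) (k : ℕ) (t : ℝ) : ℝ :=
  if Even k then max (t - p) 0 else max (q - t) 0

theorem oscillation_nonneg (p q : ℝ) (k : ℕ) (t : ℝ) : 0 ≤ oscillation p q k t := by
  unfold oscillation
  split_ifs <;> exact le_max_right _ _

theorem continuous_oscillation (p q : ℝ) (k : ℕ) : Continuous (oscillation p q k) := by
  unfold oscillation
  split_ifs <;> fun_prop

/-- If oscillations between any two rationals are bounded in length along the increasing tuples of
a tail of `(a_i)`, then the asymptotic value sequences converge: no two levels are crossed
infinitely often. -/
theorem IsAsymptoticValue.tendsto_of_patternInf_pos {a : ℕ → α → M} {w : ℕ → ℝ}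
    (hw : IsAsymptoticValue f B a w)
    (h : ∀ p q : ℚ, p < q → ∃ n m : ℕ, ∀ j : ℕ → ℕ, StrictMono j → m ≤ j 0 →
      0 < patternInf f B (oscillation p q) n fun z => a (j z.1) z.2) :
    ∃ l, Tendsto w atTop (𝓝 l) := by
  obtain ⟨K, hK⟩ := f.definable.bounded
  have hwK := hw.abs_apply_le hK
  refine tendsto_of_no_upcrossings (s := Set.range ((↑) : ℚ → ℝ)) Rat.denseRange_cast ?_
    (isBoundedUnder_of ⟨K, fun i => (abs_le.1 (hwK i)).2⟩)
    (isBoundedUnder_of ⟨-K, fun i => (abs_le.1 (hwK i)).1⟩)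
  rintro _ ⟨p, rfl⟩ _ ⟨q, rfl⟩ hpq ⟨hp, hq⟩
  obtain ⟨n, m, hnm⟩ := h p q (Rat.cast_lt.1 hpq)
  obtain ⟨j, hj, hjw⟩ := extraction_forall_of_frequently
    (P := fun k i => m ≤ i ∧ if Even k then w i < p else q < w i) fun k => by
      split_ifs
      exacts [(hp.and_eventually (eventually_ge_atTop m)).mono fun i => And.symm,
        (hq.and_eventually (eventually_ge_atTop m)).mono fun i => And.symm]
  set δ := patternInf f B (oscillation p q) n fun z => a (j z.1) z.2 with hδ
  have hδ0 : 0 < δ := hnm j hj (hjw 0).1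
  obtain ⟨y, hy, hyw⟩ := hw (j n) (δ / (n + 2)) (by positivity)
  have h1 := patternInf_le (f := f) (B := B) (oscillation_nonneg (p : ℝ) q) (n := n)
    (fun z => a (j z.1) z.2) hy.le fun k => by
      have h2 := abs_lt.1 (hyw (j k) (hj k.2))
      have h3 := (hjw k).2
      have h4 : 0 ≤ δ / (n + 2) := by positivity
      unfold oscillation
      split_ifs at h3 ⊢
      · exact max_le (by linarith [h2.2]) h4
      · exact max_le (by linarith [h2.1]) h4
  have h3 : ((n : ℝ) + 1) * (δ / (n + 2)) < δ := by
    rw [mul_div_assoc', div_lt_iff₀ (by positivity)]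
    nlinarith
  exact absurd (hδ.trans_le h1) (not_le.2 h3)

end pattern

/-! ### Indiscernible sequences -/

section indiscernible

variable {α β : Type} [Encodable α] [Encodable β]
variable {f : S.DefPred (α ⊕ β)} {A : Set (α → M)} {B : Set (β → M)}

/-- A bounded sequence that recurs in `T` has a limit value in the closure of `T`. -/
theorem exists_frequent_value {w : ℕ → ℝ} (hw : ∃ K : ℝ, ∀ i, |w i| ≤ K) {T : Set ℝ}
    (hT : ∃ᶠ i in atTop, w i ∈ T) :
    ∃ r ∈ closure T, ∀ ε > 0, ∃ᶠ i in atTop, |w i - r| < ε := by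
  have hne : (atTop ⊓ 𝓟 {i | w i ∈ T}).NeBot := frequently_mem_iff_neBot.1 hT
  have hle := Ultrafilter.of_le (atTop ⊓ 𝓟 {i | w i ∈ T})
  obtain ⟨r, hr⟩ := exists_tendsto_of_bounded (Ultrafilter.of (atTop ⊓ 𝓟 {i | w i ∈ T})) hw
  refine ⟨r, mem_closure_of_tendsto hr (hle (mem_inf_of_right (mem_principal_self _))),
    fun ε hε => ?_⟩
  exact ((Metric.tendsto_nhds.1 hr ε hε).frequently.filter_mono hle).filter_mono inf_le_left

/-- Two values that recur in `(f(a_i, b))`, for `(a_i)` indiscernible, form arbitrary patterns: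
any finite pattern occurs along some increasing tuple of indices for the fixed `b`, hence by
indiscernibility along the initial indices for some other tuple, up to small errors. -/
theorem IsIndiscernible.isAsymptoticValue (hB : S.IsDefinableSet B) {a : ℕ → α → M}
    (ha : S.IsIndiscernible a) {b : β → M} (hb : b ∈ B) {r s : ℝ}
    (hr : ∀ ε > 0, ∃ᶠ i in atTop, |f (Sum.elim (a i) b) - r| < ε)
    (hs : ∀ ε > 0, ∃ᶠ i in atTop, |f (Sum.elim (a i) b) - s| < ε)
    {w : ℕ → ℝ} (hw : ∀ i, w i = r ∨ w i = s) : IsAsymptoticValue f B a w := by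
  intro n ε hε
  -- The distance to `B` and the `n` deviations, each at most `ε / (n + 2)`, add up to less
  -- than `ε`.
  have hδ : 0 < ε / (n + 2) := by positivity
  obtain ⟨j, hj, hjw⟩ := extraction_forall_of_frequently
    (P := fun k i => |f (Sum.elim (a i) b) - w k| < ε / (n + 2)) fun k => by
      rcases hw k with h | h <;> rw [h]
      exacts [hr _ hδ, hs _ hδ]
  have hg0 : ∀ (k : ℕ) (t : ℝ), 0 ≤ |t - w k| := fun _ _ => abs_nonneg _
  have h1 := patternInf_le (f := f) (B := B) (g := fun k t => |t - w k|) (n := n) hg0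
    (fun z => a (j z.1) z.2) (y := b) (((hB.distTo_eq_zero_iff b).2 hb).trans_le hδ.le)
    fun k => (hjw k).le
  have h2 : patternInf f B (fun k t => |t - w k|) n (fun z => a (j z.1) z.2) =
      patternInf f B (fun k t => |t - w k|) n (fun z => a z.1 z.2) := apply_eq_of_tp_eq
    (ha n (fun k => j k) fun k l hkl => hj hkl)
    ⟨_, isDefinable_patternInf f hB (g := fun k t => |t - w k|) (fun k => by fun_prop) n⟩
  have h3 : ((n : ℝ) + 1) * (ε / (n + 2)) < ε := by
    rw [mul_div_assoc', div_lt_iff₀ (by positivity)]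
    nlinarith
  rw [h2] at h1
  obtain ⟨y, hy, hyw⟩ := exists_lt_of_patternInf_lt hg0 (h1.trans_lt h3)
  exact ⟨y, hy, fun i hi => hyw ⟨i, hi⟩⟩

theorem LacksIP.convergesOnIndiscernibles {hB : S.IsDefinableSet B} (h : LacksIP f A hB) :
    ConvergesOnIndiscernibles f A B := by
  intro a haA ha b hb
  obtain ⟨K, hK⟩ := f.definable.bounded
  have hbd : ∃ K : ℝ, ∀ i, |f (Sum.elim (a i) b)| ≤ K := ⟨K, fun i => hK _⟩
  refine tendsto_of_no_upcrossings dense_univ ?_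
    (isBoundedUnder_of ⟨K, fun i => (abs_le.1 (hK _)).2⟩)
    (isBoundedUnder_of ⟨-K, fun i => (abs_le.1 (hK _)).1⟩)
  rintro p - q - hpq ⟨hp, hq⟩
  obtain ⟨r, hrp, hr⟩ := exists_frequent_value hbd (T := Set.Iio p) hp
  obtain ⟨s, hsq, hs⟩ := exists_frequent_value hbd (T := Set.Ioi q) hq
  rw [closure_Iio] at hrp
  rw [closure_Ioi] at hsq
  refine (lacksIP_iff f A hB).1 h ⟨r, s, ?_, a, haA, fun w hw =>
    ha.isAsymptoticValue hB hb hr hs hw⟩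
  exact (lt_of_le_of_lt hrp (hpq.trans_le hsq)).ne

/-- A counterexample in an elementary extension is carried by saturation to one in the structure. -/
theorem ConvergesOnIndiscernibles.ext (hS : S.IsEmptySaturated) (hA : S.IsDefinableSet A)
    (hB : S.IsDefinableSet B) (h : ConvergesOnIndiscernibles f A B) :
    ConvergesOnIndiscerniblesExt f A hB := by
  intro a haA ha E b hb
  obtain ⟨a', b', hb', hf, htp⟩ :=
    (E.isAsymptoticValue_extend hB hb f a).exists_realization hS hB
  have haA' : ∀ i, a' i ∈ A := fun i => by
    rw [← hA.distTo_eq_zero_iff]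
    exact (htp ⟨_, hA.definable.rename fun z => (i, z)⟩).trans
      ((hA.distTo_eq_zero_iff _).2 (haA i))
  have ha' : S.IsIndiscernible a' := fun k i hi => tp_eq_of_apply_eq fun g =>
    calc g (fun z => a' (i z.1) z.2) = g (fun z => a (i z.1) z.2) :=
        htp ⟨_, g.definable.rename fun z : Fin k × α => (i z.1, z.2)⟩
      _ = g (fun z => a z.1 z.2) := apply_eq_of_tp_eq (ha k i hi) g
      _ = g (fun z => a' z.1 z.2) :=
        (htp ⟨_, g.definable.rename fun z : Fin k × α => ((z.1 : ℕ), z.2)⟩).symm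
  obtain ⟨l, hl⟩ := h a' haA' ha' b' hb'
  exact ⟨l, by simpa only [hf] using hl⟩

/-- From any sequence, the iterated products of an ultrafilter produce an indiscernible sequence,
whose finite pieces have the limit types of the increasing tuples of the given sequence. -/
theorem IsEmptySaturated.exists_indiscernible (hS : S.IsEmptySaturated)
    (hA : S.IsDefinableSet A) (U : Ultrafilter ℕ) {a : ℕ → α → M} (haA : ∀ i, a i ∈ A) :
    ∃ a' : ℕ → α → M, (∀ i, a' i ∈ A) ∧ S.IsIndiscernible a' ∧
      ∀ (n : ℕ) (h : S.DefPred (Fin n × α)), Tendsto (fun t : ℕ → ℕ => h fun z => a (t z.1) z.2)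
        (iterUltrafilter U n) (𝓝 (h fun z => a' z.1 z.2)) := by
  obtain ⟨c, hc⟩ := hS.exists_limit (omegaUltrafilter U)
    fun t (z : ℕ × α) => a (t z.1) z.2
  have key : ∀ (n : ℕ) (j : Fin n → ℕ), StrictMono j → ∀ h : S.DefPred (Fin n × α),
      Tendsto (fun t : ℕ → ℕ => h fun z => a (t z.1) z.2)
        (iterUltrafilter U n) (𝓝 (h fun z => c (j z.1, z.2))) := by
    intro n j hj h s hs
    exact (eventually_omegaUltrafilter_comp U hj fun τ => h (fun z => a (τ z.1) z.2) ∈ s).1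
      (hc ⟨_, h.definable.rename fun z : Fin n × α => (j z.1, z.2)⟩ hs)
  refine ⟨fun i z => c (i, z), fun i => ?_, fun k i hi => tp_eq_of_apply_eq fun g => ?_,
    fun n h => key n _ Fin.val_strictMono h⟩
  · rw [← hA.distTo_eq_zero_iff]
    refine tendsto_nhds_unique (hc ⟨_, hA.definable.rename fun z => (i, z)⟩) ?_
    exact tendsto_const_nhds.congr fun t => ((hA.distTo_eq_zero_iff _).2 (haA (t i))).symm
  · exact tendsto_nhds_unique (key k i hi g) (key k _ Fin.val_strictMono g)

/-- Along an indiscernible sequence, convergence bounds the length of oscillations: arbitrarily long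
ones would produce, by compactness, an asymptotic value sequence oscillating forever. -/
theorem ConvergesOnIndiscerniblesExt.exists_patternInf_pos {hB : S.IsDefinableSet B}
    (h : ConvergesOnIndiscerniblesExt f A hB) {a : ℕ → α → M} (haA : ∀ i, a i ∈ A)
    (ha : S.IsIndiscernible a) {p q : ℝ} (hpq : p < q) :
    ∃ n, 0 < patternInf f B (oscillation p q) n fun z => a z.1 z.2 := by
  by_contra! hcon
  choose y hy hyo using fun n : ℕ => exists_lt_of_patternInf_lt (oscillation_nonneg p q)
    ((hcon n).trans_lt (Nat.one_div_pos_of_nat (α := ℝ) (n := n)))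
  have hlim : Tendsto (fun n : ℕ => 1 / ((n : ℝ) + 1)) (hyperfilter ℕ) (𝓝 0) :=
    tendsto_one_div_add_atTop_nhds_zero_nat.mono_left Nat.hyperfilter_le_atTop
  -- The limit values along the approximate witnesses oscillate between `p` and `q`.
  choose w hw using fun k => exists_tendsto_of_bounded (hyperfilter ℕ)
    (f.definable.bounded.imp fun K hK n => hK (Sum.elim (a k) (y n)))
  have hAV : IsAsymptoticValue f B a w := isAsymptoticValue_of_tendsto
    (squeeze_zero (fun n => distTo_nonneg _ _) (fun n => (hy n).le) hlim) hw
  have hosc : ∀ k, oscillation p q k (w k) ≤ 0 := fun k => by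
    refine le_of_tendsto_of_tendsto (((continuous_oscillation p q k).tendsto _).comp (hw k))
      hlim ?_
    filter_upwards [eventually_hyperfilter_ge (k + 1)] with n hn
    exact (hyo n ⟨k, hn⟩).le
  obtain ⟨b, hb, hf⟩ := hAV.exists_ultrapower hB
  obtain ⟨l, hl⟩ := h a haA ha _ b hb
  simp only [hf] at hl
  have h1 : l ≤ p := by
    refine le_of_tendsto (hl.comp (strictMono_mul_left_of_pos (two_pos)).tendsto_atTop)
      (Eventually.of_forall fun k => ?_)
    have := hosc (2 * k)
    rw [oscillation, if_pos (even_two_mul k)] at this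
    simpa using (le_max_left _ _).trans this
  have h2 : q ≤ l := by
    refine ge_of_tendsto
      (hl.comp ((strictMono_mul_left_of_pos (two_pos)).add_const 1).tendsto_atTop)
      (Eventually.of_forall fun k => ?_)
    have := hosc (2 * k + 1)
    rw [oscillation, if_neg (Nat.not_even_iff_odd.2 (odd_two_mul_add_one k))] at this
    simpa using (le_max_left _ _).trans this
  linarith

/-- Every sequence has a subsequence whose increasing tuples are generic for a nonprincipal
ultrafilter; the oscillations along it are as bounded as they are along the indiscernible sequence
generated by the ultrafilter. -/
theorem ConvergesOnIndiscerniblesExt.hasConvergentSubsequences (hS : S.IsEmptySaturated)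
    (hA : S.IsDefinableSet A) {hB : S.IsDefinableSet B}
    (h : ConvergesOnIndiscerniblesExt f A hB) : HasConvergentSubsequences f A hB := by
  intro a haA
  obtain ⟨a', haA', ha', hlim⟩ := hS.exists_indiscernible hA (hyperfilter ℕ) haA
  -- An enumeration of the pairs of rationals; for `p ≥ q` nothing is required.
  obtain ⟨e, he⟩ := exists_surjective_nat (ℚ × ℚ)
  have hn : ∀ m, ∃ n, (e m).1 < (e m).2 →
      0 < patternInf f B (oscillation (e m).1 (e m).2) n fun z => a' z.1 z.2 := fun m => by
    by_cases hm : (e m).1 < (e m).2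
    · obtain ⟨n, hn⟩ := h.exists_patternInf_pos haA' ha' (Rat.cast_lt.2 hm)
      exact ⟨n, fun _ => hn⟩
    · exact ⟨0, fun h => absurd h hm⟩
  choose n hn using hn
  obtain ⟨φ, hφ, hφQ⟩ := exists_generic_subsequence Nat.hyperfilter_le_atTop n
    (fun m t => (e m).1 < (e m).2 →
      0 < patternInf f B (oscillation (e m).1 (e m).2) (n m) fun z => a (t z.1) z.2) fun m => by
    by_cases hm : (e m).1 < (e m).2
    · filter_upwards [(hlim (n m) ⟨_, isDefinable_patternInf f hB
        (continuous_oscillation _ _) (n m)⟩).eventually (lt_mem_nhds (hn m hm))] with t ht _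
      exact ht
    · exact Eventually.of_forall fun t ht => absurd ht hm
  refine ⟨φ, hφ, fun E b hb => ?_⟩
  refine (E.isAsymptoticValue_extend hB hb f (a ∘ φ)).tendsto_of_patternInf_pos
    fun p q hpq => ?_
  obtain ⟨m, hm⟩ := he (p, q)
  refine ⟨n m, m, fun j hj hmj => ?_⟩
  have := hφQ m j hj hmj
  simp only [hm, Fin.is_lt, if_true] at this
  exact this hpq

end indiscernible

/-! ### Sequential precompactness on the type space -/

section precompact

variable {α β : Type}

theorem uniformContinuous_sumElim :
    UniformContinuous fun z : (β → M) × (α → M) => Sum.elim z.2 z.1 := by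
  refine uniformContinuous_pi.2 fun i => ?_
  cases i with
  | inl i => exact (Pi.uniformContinuous_proj (fun _ : α => M) i).comp uniformContinuous_snd
  | inr i => exact (Pi.uniformContinuous_proj (fun _ : β => M) i).comp uniformContinuous_fst

variable [Encodable β] {f : S.DefPred (α ⊕ β)} {A : Set (α → M)} {B : Set (β → M)}

/-- Only the values at countably many predicates matter, so each type in `B*` can be replaced by a
tuple of the ultrapower. -/
theorem HasConvergentSubsequences.isSeqPrecompact [Encodable α] {hB : S.IsDefinableSet B}
    (h : HasConvergentSubsequences f A hB) : IsSeqPrecompact (typeFunctions f A hB) := by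
  intro u hu
  choose a haA hau using hu
  obtain ⟨φ, hφ, hconv⟩ := h a haA
  have hlim : ∀ p : hB.typeSet, ∃ l, Tendsto (fun i => u (φ i) p) atTop (𝓝 l) := fun p => by
    obtain ⟨b, hb, hf⟩ :=
      (hB.isAsymptoticValue_value p.2 f fun i => a (φ i)).exists_ultrapower hB
    obtain ⟨l, hl⟩ := hconv _ b hb
    refine ⟨l, ?_⟩
    simp only [hf] at hl
    simpa only [← hau] using hl
  choose x hx using hlim
  exact ⟨φ, hφ, x, tendsto_pi_nhds.2 hx⟩

theorem abs_value_sub_value_le {C : Set M} (p : S.TypeSpace C β) {g h : S.defAlgebra C β} {ε : ℝ}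
    (hgh : ∀ b, |(g : (β → M) → ℝ) b - (h : (β → M) → ℝ) b| ≤ ε) :
    |value p g - value p h| ≤ ε := by
  classical
  refine le_of_forall_pos_le_add fun δ hδ => ?_
  obtain ⟨b, -, hb⟩ := approxFinRealized_univ p (δ / 2) (half_pos hδ)
    {g - algebraMap ℝ _ (value p g), h - algebraMap ℝ _ (value p h)} (by
      intro k hk
      rcases Finset.mem_insert.1 hk with rfl | hk
      · exact value_spec p g
      · rw [Finset.mem_singleton.1 hk]
        exact value_spec p h)
  have h1 := hb _ (Finset.mem_insert_self _ _)
  have h2 := hb _ (Finset.mem_insert_of_mem (Finset.mem_singleton_self _))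
  change |(g : (β → M) → ℝ) b - value p g| < δ / 2 at h1
  change |(h : (β → M) → ℝ) b - value p h| < δ / 2 at h2
  have h3 := abs_le.1 (hgh b)
  rw [abs_lt] at h1 h2
  rw [abs_le]
  constructor <;> linarith [h1.1, h1.2, h2.1, h2.2, h3.1, h3.2]

/-- Sequential precompactness on a dense subset excludes independence: an independent sequence is
uniformly approximated from the dense subset, and a convergent subsequence of the approximation
oscillates at the type realizing the set of its terms of even index. -/
theorem lacksIP_of_isSeqPrecompact [Encodable α] {hB : S.IsDefinableSet B} {A' : Set (α → M)}
    (hA' : A ⊆ closure A') (h : IsSeqPrecompact (typeFunctions f A' hB)) : LacksIP f A hB := by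
  rw [lacksIP_iff]
  rintro ⟨r, s, hrs, a, haA, hAV⟩
  have hε : 0 < |r - s| / 3 := by
    have := abs_pos.2 (sub_ne_zero.2 hrs)
    positivity
  have happ : ∀ i, ∃ a' ∈ A', ∀ b, |f (Sum.elim (a i) b) - f (Sum.elim a' b)| < |r - s| / 3 :=
    fun i => by
      have hu := eventually_forall_abs_sub_lt
        (f.definable.uniformContinuous.comp (uniformContinuous_sumElim (M := M))) hε
      obtain ⟨a', hb, ha'⟩ := mem_closure_iff_nhds.1 (hA' (haA i)) _ (mem_nhds_left (a i) hu)
      exact ⟨a', ha', hb⟩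
  choose a' ha' haa' using happ
  obtain ⟨φ, hφ, x, hx⟩ := h (fun i p => value p.1 (f.slice (a' i)))
    fun i => ⟨a' i, ha' i, rfl⟩
  classical
  obtain ⟨p, hp, hpw⟩ := (hAV (fun i => if ∃ k, i = φ (2 * k) then r else s) fun i => by
    by_cases hi : ∃ k, i = φ (2 * k) <;> simp [hi]).exists_type hB
  have hxp := tendsto_pi_nhds.1 hx ⟨p, hp⟩
  have hval : ∀ i, |value p (f.slice (a i)) - value p (f.slice (a' i))| ≤ |r - s| / 3 :=
    fun i => abs_value_sub_value_le p fun b => (haa' i b).le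
  have h1 : |r - x ⟨p, hp⟩| ≤ |r - s| / 3 := by
    refine le_of_tendsto (tendsto_const_nhds.sub
      (hxp.comp (strictMono_mul_left_of_pos (two_pos)).tendsto_atTop)).abs
      (Eventually.of_forall fun k => ?_)
    have := hval (φ (2 * k))
    rwa [hpw, if_pos ⟨k, rfl⟩] at this
  have h2 : |s - x ⟨p, hp⟩| ≤ |r - s| / 3 := by
    refine le_of_tendsto (tendsto_const_nhds.sub
      (hxp.comp ((strictMono_mul_left_of_pos (two_pos)).add_const 1).tendsto_atTop)).abs
      (Eventually.of_forall fun k => ?_)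
    have := hval (φ (2 * k + 1))
    rwa [hpw, if_neg] at this
    rintro ⟨l, hl⟩
    have := hφ.injective hl
    omega
  have h3 := abs_sub_le r (x ⟨p, hp⟩) s
  rw [abs_sub_comm (x ⟨p, hp⟩) s] at h3
  linarith

end precompact

end MetricStructure

theorem IsSeqPrecompact.mono {X : Type*} [TopologicalSpace X] {s t : Set X}
    (h : IsSeqPrecompact t) (hst : s ⊆ t) : IsSeqPrecompact s :=
  fun u hu => h u fun n => hst (hu n)

end MetricModel

theorem mainTheorem12 {L : MetricModel.Signature} {M : Type*} [MetricSpace M]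
    (S : MetricModel.MetricStructure L M) (hS : S.IsEmptySaturated)
    {α β : Type} [Encodable α] [Encodable β] (f : S.DefPred (α ⊕ β))
    (A : Set (α → M)) (B : Set (β → M)) (hA : S.IsDefinableSet A) (hB : S.IsDefinableSet B) :
    List.TFAE
      [MetricModel.MetricStructure.LacksIP f A hB,
        MetricModel.MetricStructure.ConvergesOnIndiscernibles f A B,
        MetricModel.MetricStructure.ConvergesOnIndiscerniblesExt f A hB,
        MetricModel.MetricStructure.HasConvergentSubsequences f A hB,
        MetricModel.IsSeqPrecompact (MetricModel.MetricStructure.typeFunctions f A hB)] ∧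
    ∀ A' : Set (α → M), A' ⊆ A → A ⊆ closure A' →
      (MetricModel.MetricStructure.LacksIP f A hB ↔
        MetricModel.IsSeqPrecompact (MetricModel.MetricStructure.typeFunctions f A' hB)) := by
  have htfae : List.TFAE
      [MetricModel.MetricStructure.LacksIP f A hB,
        MetricModel.MetricStructure.ConvergesOnIndiscernibles f A B,
        MetricModel.MetricStructure.ConvergesOnIndiscerniblesExt f A hB,
        MetricModel.MetricStructure.HasConvergentSubsequences f A hB,
        MetricModel.IsSeqPrecompact (MetricModel.MetricStructure.typeFunctions f A hB)] := by
    tfae_have 1 → 2 := fun h => h.convergesOnIndiscernibles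
    tfae_have 2 → 3 := fun h => h.ext hS hA hB
    tfae_have 3 → 4 := fun h => h.hasConvergentSubsequences hS hA
    tfae_have 4 → 5 := fun h => h.isSeqPrecompact
    tfae_have 5 → 1 := MetricModel.MetricStructure.lacksIP_of_isSeqPrecompact subset_closure
    tfae_finish
  refine ⟨htfae, fun A' hA' hd => ⟨fun h => ?_,
    MetricModel.MetricStructure.lacksIP_of_isSeqPrecompact hd⟩⟩
  have hA5 : MetricModel.IsSeqPrecompact (MetricModel.MetricStructure.typeFunctions f A hB) :=
    (htfae.out 0 4).1 h
  exact hA5.mono (Set.image_mono hA')
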